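/- Let $K$ be a non-archimedean local field of characteristic $0$. Give $\mathrm{PSL}_2(K)=\mathrm{SL}_2(K)/\{\pm I\}$ the quotient of the topology on $\mathrm{SL}_2(K)$ induced by $K$. Let $G$ be a discrete subgroup of $\mathrm{PSL}_2(K)$ with no $2$-torsion, i.e. with no element of order $2$. Then $G$ is a free product of a (possibly empty or infinite) family of subgroups, each of which is either a cyclic group (finite or infinite) or isomorphic to the direct product of a finite cyclic group and an infinite cyclic group. -/

import Mathlib

open scoped MatrixGroups

universe u

/-- `G` is the (internal) free product of the family of subgroups `H i`: the canonical
homomorphism from the free product of the `H i` to `G` is an isomorphism. -/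
def IsFreeProductOf {G : Type*} [Group G] {ι : Type*} (H : ι → Subgroup G) : Prop :=
  Function.Bijective (Monoid.CoprodI.lift fun i => (H i).subtype)

/-- `H` is isomorphic to the direct product of a finite cyclic group and an infinite
cyclic group. -/
def IsFiniteCyclicProdInfiniteCyclic (H : Type*) [Group H] : Prop :=
  ∃ n : ℕ, 0 < n ∧ Nonempty (H ≃* Multiplicative (ZMod n) × Multiplicative ℤ)

/-! `G` acts on the Bruhat–Tits tree of `PSL₂(K)`. Discreteness makes the vertex stabilizers finite
(`finite_stabilizer_vertex`). Having no involution, they have odd order, and this makes them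
commutative: by Schur–Zassenhaus such a group lifts to `SL₂(K)`, where a count of traces rules out
an irreducible two-dimensional representation (`commute_of_finite`).

Edges may have nontrivial stabilizers, so every component of the graph of edges fixed by a
nontrivial element is collapsed to a point. The result is again a tree, now with trivial edge
stabilizers; nothing inverts an edge, since the square of an inversion would be trivial. Ping-pong
with the half-spaces around a fundamental subtree then shows that `G` is the free product of
stabilizers of components and of cyclic groups generated by stable letters
(`exists_isFreeProductOf_of_isTree`).

It remains to understand the stabilizer of a component. Commutation is transitive in `G`: the
centralizer of an element `a` with `a ^ 2 ≠ 1` comes from the commutative algebra generated by a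
lift of `a`. Passing from vertex to vertex through elements that fix the edge between them, one
finds that all vertex groups of the component commute with a single torsion element `a ≠ 1`. If `g`
preserves the component, then `g * a * g⁻¹` commutes with `a`, and comparing traces and determinants
makes it `a` or `a⁻¹`. In the second case `g ^ 2` commutes with both `a` and `g`, so `g` commutes
with `a` after all (`eq_bot_or_exists_torsion_commute`).

So the stabilizer is a discrete subgroup of a torus (`isCyclic_or_prod_of_commute_torsion`). A
nonsplit torus is compact, which leaves a finite group; in the split case the valuation of the
squared eigenvalue is a map to `ℤ` with finite kernel. Finite subgroups are cyclic because they
embed in the multiplicative group of a field. -/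

/-! ### A ping-pong criterion with base points -/

/-- A version of the ping-pong lemma in which every factor comes with a base point outside all
ping-pong sets. The base point is either moved into the ping-pong set of its factor, or
fixed by its factor and moved properly by all the others. -/
theorem lift_injective_of_ping_pong_basePoints {G V ι : Type*} [Group G] [MulAction G V]
    (H : ι → Subgroup G) (X : ι → Set V) (b : ι → V) (hb : ∀ i j, b i ∉ X j)
    (hX : ∀ i j, i ≠ j → ∀ h ∈ H i, h ≠ 1 → ∀ z ∈ X j, h • z ∈ X i)
    (hbase : ∀ i, (∀ h ∈ H i, h ≠ 1 → h • b i ∈ X i) ∨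
      ((∀ h ∈ H i, h • b i = b i) ∧ ∀ j, j ≠ i → ∀ h ∈ H j, h ≠ 1 → h • b i ∈ X j)) :
    Function.Injective (Monoid.CoprodI.lift fun i => (H i).subtype) := by
  classical
  set f := Monoid.CoprodI.lift fun i => (H i).subtype
  have key1 : ∀ {i j} (w : Monoid.CoprodI.NeWord (fun i => H i) i j) (k), j ≠ k →
      ∀ z ∈ X k, f w.prod • z ∈ X i := by
    intro i j w
    induction w with
    | singleton x hx =>
      intro k hk z hz
      simpa [f] using hX _ _ hk x x.2 (by simpa using hx) z hz
    | append w₁ hne w₂ ih₁ ih₂ =>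
      intro k hk z hz
      rw [Monoid.CoprodI.NeWord.append_prod, map_mul, mul_smul]
      exact ih₁ _ hne _ (ih₂ _ hk _ hz)
  have key2 : ∀ {i j} (w : Monoid.CoprodI.NeWord (fun i => H i) i j) (k), j ≠ k →
      (∀ l, l ≠ k → ∀ h ∈ H l, h ≠ 1 → h • b k ∈ X l) → f w.prod • b k ∈ X i := by
    intro i j w
    induction w with
    | singleton x hx =>
      intro k hk hl
      simpa [f] using hl _ hk x x.2 (by simpa using hx)
    | append w₁ hne w₂ ih₁ ih₂ =>
      intro k hk hl
      rw [Monoid.CoprodI.NeWord.append_prod, map_mul, mul_smul]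
      exact key1 w₁ _ hne _ (ih₂ _ hk hl)
  -- A reduced word is tested on the base point of its last letter. The second alternative occurs
  -- only for a single letter that fixes this point; it records that every other factor moves the
  -- point properly, so that one more letter leads to the first alternative.
  have key3 : ∀ {i j} (w : Monoid.CoprodI.NeWord (fun i => H i) i j),
      f w.prod • b j ∈ X i ∨ (i = j ∧ f w.prod • b j = b j ∧ f w.prod ≠ 1 ∧
        ∀ l, l ≠ j → ∀ h ∈ H l, h ≠ 1 → h • b j ∈ X l) := by
    intro i j w
    induction w with
    | @singleton i x hx =>
      have hx' : (x : G) ≠ 1 := by simpa using hx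
      rcases hbase i with h | ⟨h1, h2⟩
      · left; simpa [f] using h x x.2 hx'
      · right; refine ⟨rfl, by simpa [f] using h1 x x.2, by simpa [f] using hx', h2⟩
    | append w₁ hne w₂ ih₁ ih₂ =>
      rw [Monoid.CoprodI.NeWord.append_prod, map_mul, mul_smul]
      left
      rcases ih₂ with h | ⟨rfl, h1, -, h2⟩
      · exact key1 w₁ _ hne _ h
      · rw [h1]; exact key2 w₁ _ hne h2
  rw [injective_iff_map_eq_one]
  intro a ha
  obtain ⟨w, rfl⟩ := Monoid.CoprodI.Word.equiv.symm.surjective a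
  by_contra hne
  have hw : w ≠ Monoid.CoprodI.Word.empty := by
    rintro rfl
    exact hne (Monoid.CoprodI.Word.prod_empty)
  obtain ⟨i, j, w', rfl⟩ := Monoid.CoprodI.NeWord.of_word w hw
  have ha' : f w'.prod = 1 := ha
  rcases key3 w' with h | ⟨-, -, h, -⟩
  · rw [ha', one_smul] at h
    exact hb _ _ h
  · exact h ha'

/-! ### Half-spaces of a tree -/

namespace SimpleGraph

variable {V : Type*} {T : SimpleGraph V}

lemma Reachable.induction_on {P : V → Prop} {a b : V} (h : T.Reachable a b) (ha : P a)
    (hstep : ∀ x y, T.Adj x y → P x → P y) : P b := by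
  obtain ⟨w⟩ := h
  induction w with
  | nil => exact ha
  | cons hxy _ ih => exact ih (hstep _ _ hxy ha)

/-- The half-space in front of the oriented edge from `v` to `y`: the component of `y` after
this edge is removed. -/
def halfSpace (T : SimpleGraph V) (v y : V) : Set V :=
  {z | (T.deleteEdges {s(v, y)}).Reachable y z}

lemma mem_halfSpace_self (v y : V) : y ∈ T.halfSpace v y := Reachable.refl _

lemma IsAcyclic.notMem_halfSpace (hT : T.IsAcyclic) {v y : V} (h : T.Adj v y) :
    v ∉ T.halfSpace v y := by
  intro hv
  have := isAcyclic_iff_forall_adj_isBridge.1 hT h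
  rw [isBridge_iff] at this
  exact this (Reachable.symm hv)

lemma eq_of_adj_halfSpace {v y a b : V} (hv : v ∉ T.halfSpace v y) (h : T.Adj a b)
    (ha : a ∉ T.halfSpace v y)
    (hb : b ∈ T.halfSpace v y) : a = v ∧ b = y := by
  by_cases hab : s(a, b) = s(v, y)
  · rcases Sym2.eq_iff.1 hab with h' | ⟨-, rfl⟩
    · exact h'
    · exact absurd hb hv
  · refine absurd (Reachable.trans hb (Adj.reachable ?_)) ha
    rw [deleteEdges_adj]
    exact ⟨h.symm, by rwa [Set.mem_singleton_iff, Sym2.eq_swap]⟩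

lemma Connected.mem_halfSpace_or (hT : T.Connected) {v y : V} (z : V) :
    z ∈ T.halfSpace v y ∨ z ∈ T.halfSpace y v := by
  refine (hT.preconnected y z).induction_on
    (P := fun z => z ∈ T.halfSpace v y ∨ z ∈ T.halfSpace y v)
    (Or.inl (mem_halfSpace_self _ _)) ?_
  intro a b hab h
  by_cases hab' : s(a, b) = s(v, y)
  · rcases Sym2.eq_iff.1 hab' with ⟨-, rfl⟩ | ⟨-, rfl⟩
    · exact Or.inl (mem_halfSpace_self _ _)
    · exact Or.inr (mem_halfSpace_self _ _)
  · refine h.imp (fun h => Reachable.trans h (Adj.reachable ?_))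
      (fun h => Reachable.trans h (Adj.reachable ?_))
    · rw [deleteEdges_adj]; exact ⟨hab, hab'⟩
    · rw [deleteEdges_adj]; exact ⟨hab, by rwa [Sym2.eq_swap (a := y)]⟩

lemma smul_mem_halfSpace {G : Type*} [Group G] [MulAction G V]
    (hinv : ∀ (g : G) (x y : V), T.Adj x y → T.Adj (g • x) (g • y)) (g : G) {v y z : V}
    (h : z ∈ T.halfSpace v y) : g • z ∈ T.halfSpace (g • v) (g • y) := by
  refine Reachable.induction_on (P := fun z => g • z ∈ T.halfSpace (g • v) (g • y)) h
    (mem_halfSpace_self _ _) ?_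
  intro a b hab ha
  refine Reachable.trans ha (Adj.reachable ?_)
  rw [deleteEdges_adj] at hab ⊢
  refine ⟨hinv _ _ _ hab.1, fun h => hab.2 ?_⟩
  simp only [Set.mem_singleton_iff, Sym2.eq_iff, smul_left_cancel_iff] at h ⊢
  exact h

/-- `D` meets no half-space in front of an edge that leaves `D`. -/
def IsGeodesicallyClosed (T : SimpleGraph V) (D : Set V) : Prop :=
  ∀ ⦃v y⦄, v ∈ D → y ∉ D → T.Adj v y → ∀ d ∈ D, d ∉ T.halfSpace v y

/-- The half-spaces hanging off `D` are pairwise disjoint. A path inside the first one can enter the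
second only through `v'`, which lies in `D`, and the first contains no point of `D`. -/
lemma IsGeodesicallyClosed.eq_of_mem (hT : T.IsAcyclic) {D : Set V}
    (hD : T.IsGeodesicallyClosed D)
    {v y v' y' z : V} (hv : v ∈ D) (hy : y ∉ D) (h : T.Adj v y) (hv' : v' ∈ D) (hy' : y' ∉ D)
    (h' : T.Adj v' y') (hz : z ∈ T.halfSpace v y) (hz' : z ∈ T.halfSpace v' y') :
    v = v' ∧ y = y' := by
  by_contra hne
  have hvv := hT.notMem_halfSpace h'
  suffices hh : z ∈ T.halfSpace v y ∧ z ∉ T.halfSpace v' y' from hh.2 hz'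
  refine Reachable.induction_on
    (P := fun z => z ∈ T.halfSpace v y ∧ z ∉ T.halfSpace v' y') hz ⟨mem_halfSpace_self _ _, ?_⟩ ?_
  · intro hh
    exact hne (eq_of_adj_halfSpace hvv h (hD hv' hy' h' v hv) hh)
  · rintro a b hab ⟨ha, ha'⟩
    refine ⟨Reachable.trans ha hab.reachable, fun hb => ?_⟩
    rw [deleteEdges_adj] at hab
    obtain ⟨rfl, rfl⟩ := eq_of_adj_halfSpace hvv hab.1 ha' hb
    exact hD hv hy h _ hv' ha

lemma IsGeodesicallyClosed.singleton (hT : T.IsAcyclic) (x : V) :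
    T.IsGeodesicallyClosed {x} := by
  rintro v y rfl - h d rfl
  exact hT.notMem_halfSpace h

lemma IsGeodesicallyClosed.exists_mem_halfSpace (hT : T.Connected) {D : Set V} {x₀ : V}
    (hx₀ : x₀ ∈ D) {z : V} (hz : z ∉ D) :
    ∃ v y, v ∈ D ∧ y ∉ D ∧ T.Adj v y ∧ z ∈ T.halfSpace v y := by
  have : z ∈ D ∨ ∃ v y, v ∈ D ∧ y ∉ D ∧ T.Adj v y ∧ z ∈ T.halfSpace v y := by
    refine (hT.preconnected x₀ z).induction_on
      (P := fun z => z ∈ D ∨ ∃ v y, v ∈ D ∧ y ∉ D ∧ T.Adj v y ∧ z ∈ T.halfSpace v y)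
      (Or.inl hx₀) ?_
    rintro a b hab (ha | ⟨v, y, hv, hy, h, ha⟩)
    · by_cases hb : b ∈ D
      · exact Or.inl hb
      · exact Or.inr ⟨a, b, ha, hb, hab, mem_halfSpace_self _ _⟩
    · by_cases hab' : s(a, b) = s(v, y)
      · rcases Sym2.eq_iff.1 hab' with ⟨-, rfl⟩ | ⟨-, rfl⟩
        · exact Or.inr ⟨v, b, hv, hy, h, mem_halfSpace_self _ _⟩
        · exact Or.inl hv
      · refine Or.inr ⟨v, y, hv, hy, h, Reachable.trans ha (Adj.reachable ?_)⟩
        rw [deleteEdges_adj]; exact ⟨hab, hab'⟩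
  exact this.resolve_left hz

lemma IsGeodesicallyClosed.insert (hT : T.IsTree) {D : Set V} (hD : T.IsGeodesicallyClosed D)
    {v₀ y : V} (hv₀ : v₀ ∈ D) (hy : y ∉ D) (h₀ : T.Adj v₀ y) :
    T.IsGeodesicallyClosed (insert y D) := by
  rintro v y' hv hy' h d hd hmem
  rw [Set.mem_insert_iff, not_or] at hy'
  have hvv := hT.isAcyclic.notMem_halfSpace h
  rcases hv with rfl | hv <;> rcases hd with rfl | hd
  · exact hvv hmem
  -- The edge leaves the new vertex. All of `D` lies in the direction of `v₀`, and different
  -- directions at one vertex are disjoint.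
  · have h1 : d ∈ T.halfSpace v v₀ :=
      (hT.connected.mem_halfSpace_or d).resolve_left (hD hv₀ hy h₀ d hd)
    have h2 := (IsGeodesicallyClosed.singleton hT.isAcyclic v).eq_of_mem hT.isAcyclic
      (Set.mem_singleton v) (by simpa using hy'.1) h (Set.mem_singleton v)
      (by simpa using h₀.ne) h₀.symm hmem h1
    exact hy'.2 (h2.2 ▸ hv₀)
  · exact hy'.1 (eq_of_adj_halfSpace hvv h₀ (hD hv hy'.2 h v₀ hv₀) hmem).2.symm
  · exact hD hv hy'.2 h d hd hmem

/-- A tree with a group action contains a subtree that meets every orbit of vertices exactly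
once. -/
lemma IsTree.exists_fundamental_subtree {G : Type*} [Group G] [MulAction G V] (hT : T.IsTree)
    (hinv : ∀ (g : G) (x y : V), T.Adj x y → T.Adj (g • x) (g • y)) (x₀ : V) :
    ∃ D : Set V, x₀ ∈ D ∧ T.IsGeodesicallyClosed D ∧
      (∀ d ∈ D, ∀ g : G, g • d ∈ D → g • d = d) ∧ ∀ z, ∃ g : G, g • z ∈ D := by
  let S : Set (Set V) := {D | x₀ ∈ D ∧ T.IsGeodesicallyClosed D ∧
    ∀ d ∈ D, ∀ g : G, g • d ∈ D → g • d = d}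
  obtain ⟨D, -, hD⟩ := zorn_subset_nonempty S (by
    intro c hc hchain ⟨D₁, hD₁⟩
    have hdir : ∀ a ∈ ⋃₀ c, ∀ b ∈ ⋃₀ c, ∃ E ∈ c, a ∈ E ∧ b ∈ E := by
      rintro a ⟨A, hA, ha⟩ b ⟨B, hB, hb⟩
      rcases hchain.total hA hB with h | h
      · exact ⟨B, hB, h ha, hb⟩
      · exact ⟨A, hA, ha, h hb⟩
    refine ⟨⋃₀ c, ⟨⟨D₁, hD₁, (hc hD₁).1⟩, ?_, ?_⟩, fun s hs => Set.subset_sUnion_of_mem hs⟩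
    · intro v y hv hy h d hd
      obtain ⟨E, hE, hvE, hdE⟩ := hdir v hv d hd
      exact (hc hE).2.1 hvE (fun hyE => hy ⟨E, hE, hyE⟩) h d hdE
    · intro d hd g hg
      obtain ⟨E, hE, hdE, hgE⟩ := hdir d hd _ hg
      exact (hc hE).2.2 d hdE g hgE)
    {x₀} ⟨rfl, IsGeodesicallyClosed.singleton hT.isAcyclic x₀, by
      rintro d rfl g hg; exact hg⟩
  refine ⟨D, hD.prop.1, hD.prop.2.1, hD.prop.2.2, fun z => ?_⟩
  refine (hT.connected.preconnected x₀ z).induction_on (P := fun z => ∃ g : G, g • z ∈ D)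
    ⟨1, by rw [one_smul]; exact hD.prop.1⟩ ?_
  rintro x z hxz ⟨g, hg⟩
  by_contra! hcon
  have hins : insert (g • z) D ∈ S := by
    refine ⟨Set.mem_insert_of_mem _ hD.prop.1,
      hD.prop.2.1.insert hT hg (hcon g) (hinv g _ _ hxz), ?_⟩
    rintro d (rfl | hd) k hk
    · rcases hk with hk | hk
      · exact hk
      · rw [← mul_smul] at hk
        exact absurd hk (hcon _)
    · rcases hk with hk | hk
      · refine absurd ?_ (hcon (k⁻¹ * g))
        rwa [mul_smul, ← hk, inv_smul_smul]
      · exact hD.prop.2.2 d hd k hk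
  exact hcon g (hD.le_of_ge hins (Set.subset_insert _ _) (Set.mem_insert _ _))

end SimpleGraph

/-! ### Groups acting on trees with trivial edge stabilizers -/

section BassSerre

open SimpleGraph

variable {G V : Type u} [Group G] [MulAction G V]

/-- A transversal for the orbits of pairs, compatible with a transversal `D` for the orbits of
points. -/
lemma exists_pair_transversal {D : Set V} (hmeet : ∀ z : V, ∃ g : G, g • z ∈ D) :
    ∃ ρ : V × V → V × V, (∀ p, ∃ g : G, ρ p = g • p) ∧ (∀ (g : G) p, ρ (g • p) = ρ p) ∧
      (∀ p, (ρ p).1 ∈ D) ∧ ∀ p, (∃ g : G, (g • p).1 ∈ D ∧ (g • p).2 ∈ D) → (ρ p).2 ∈ D := by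
  -- A representative with both entries in `D` is preferred whenever the orbit has one, so that
  -- edges inside `D` represent themselves.
  have h : ∀ q : MulAction.orbitRel.Quotient G (V × V), ∃ r : V × V, (⟦r⟧ : Quotient _) = q ∧
      r.1 ∈ D ∧ ((∃ r' : V × V, (⟦r'⟧ : Quotient _) = q ∧ r'.1 ∈ D ∧ r'.2 ∈ D) → r.2 ∈ D) := by
    intro q
    by_cases hq : ∃ r' : V × V,
      (⟦r'⟧ : MulAction.orbitRel.Quotient G (V × V)) = q ∧ r'.1 ∈ D ∧ r'.2 ∈ D
    · obtain ⟨r', h1, h2, h3⟩ := hq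
      exact ⟨r', h1, h2, fun _ => h3⟩
    · obtain ⟨p, rfl⟩ := Quotient.exists_rep q
      obtain ⟨g, hg⟩ := hmeet p.1
      exact ⟨g • p, Quotient.sound ⟨g, rfl⟩, hg, fun h => absurd h hq⟩
  choose f hf1 hf2 hf3 using h
  have hsound : ∀ (g : G) (p : V × V), (⟦g • p⟧ : MulAction.orbitRel.Quotient G (V × V)) = ⟦p⟧ :=
    fun g p => Quotient.sound ⟨g, rfl⟩
  refine ⟨fun p => f ⟦p⟧, fun p => ?_, fun g p => ?_, fun p => hf2 _, ?_⟩
  · obtain ⟨g, hg⟩ := Quotient.exact (hf1 ⟦p⟧)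
    exact ⟨g, hg.symm⟩
  · simp only [hsound]
  · rintro p ⟨g, h1, h2⟩
    exact hf3 _ ⟨g • p, hsound g p, h1, h2⟩

/-- A group that acts on a tree with trivial edge stabilizers (and no inversions) is a free
product of vertex stabilizers and cyclic subgroups. -/
theorem exists_isFreeProductOf_of_isTree {T : SimpleGraph V} (hT : T.IsTree)
    (hinv : ∀ (g : G) (x y : V), T.Adj x y → T.Adj (g • x) (g • y))
    (hfree : ∀ (g : G) (x y : V), T.Adj x y → s(g • x, g • y) = s(x, y) → g = 1) :
    ∃ (ι : Type u) (H : ι → Subgroup G), IsFreeProductOf H ∧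
      ∀ i, (∃ x : V, H i = MulAction.stabilizer G x) ∨ IsCyclic (H i) := by
  classical
  obtain ⟨x₀⟩ := hT.connected.nonempty
  obtain ⟨D, hx₀, hD, hDinj, hmeet⟩ := hT.exists_fundamental_subtree hinv x₀
  obtain ⟨ρ, hρ, hρinv, hρ1, hρ2⟩ := exists_pair_transversal (G := G) hmeet
  have hfix : ∀ (g : G) (p : V × V), T.Adj p.1 p.2 → ρ p = p → ρ (g • p) = g • p → g = 1 := by
    intro g p hp h1 h2
    rw [hρinv, h1] at h2
    refine hfree g p.1 p.2 hp ?_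
    have e1 : g • p.1 = p.1 := (congrArg Prod.fst h2).symm
    have e2 : g • p.2 = p.2 := (congrArg Prod.snd h2).symm
    rw [e1, e2]
  have hstdD : ∀ p : V × V, p.1 ∈ D → p.2 ∈ D → ρ p = p := by
    intro p h1 h2
    obtain ⟨g, hg⟩ := hρ p
    have h3 := hρ1 p
    have h4 := hρ2 p ⟨1, by simpa using h1, by simpa using h2⟩
    rw [hg] at h3 h4 ⊢
    exact Prod.ext (hDinj _ h1 g h3) (hDinj _ h2 g h4)
  have hstab : ∀ v y : V, v ∈ D → ∃ h : G, h • v = v ∧ ρ (v, y) = (v, h • y) := by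
    intro v y hv
    obtain ⟨g, hg⟩ := hρ (v, y)
    have h3 := hρ1 (v, y)
    rw [hg] at h3
    have h4 := hDinj v hv g h3
    exact ⟨g, h4, by rw [hg]; exact Prod.ext h4 rfl⟩
  -- the standard edges that leave `D`, and the reversal of their orbits
  let N : Set (V × V) := {p | T.Adj p.1 p.2 ∧ ρ p = p ∧ p.2 ∉ D}
  have hN1 : ∀ p ∈ N, p.1 ∈ D := fun p hp => hp.2.1 ▸ hρ1 p
  let τ : V × V → V × V := fun p => ρ p.swap
  have hswap : ∀ (g : G) (p : V × V), (g • p).swap = g • p.swap := fun g p => rfl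
  have hττ : ∀ p ∈ N, τ (τ p) = p := by
    intro p hp
    obtain ⟨g, hg⟩ := hρ p.swap
    change ρ (ρ p.swap).swap = p
    rw [hg, hswap, hρinv, Prod.swap_swap, hp.2.1]
  have hτN : ∀ p ∈ N, τ p ∈ N := by
    intro p hp
    obtain ⟨g, hg⟩ := hρ p.swap
    have hidem : ρ (τ p) = τ p := by
      change ρ (ρ p.swap) = ρ p.swap
      rw [hg, hρinv, ← hg]
    refine ⟨?_, hidem, fun h2 => ?_⟩
    · change T.Adj (ρ p.swap).1 (ρ p.swap).2
      rw [hg]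
      exact hinv g _ _ hp.1.symm
    · have h1 := hN1 p hp
      have h3 := hstdD (τ p).swap h2 (hρ1 _)
      have h4 : τ (τ p) = (τ p).swap := h3
      rw [hττ p hp] at h4
      refine hp.2.2 ?_
      rw [h4]
      exact hρ1 _
  have hτne : ∀ p ∈ N, τ p ≠ p := by
    intro p hp h
    obtain ⟨g, hg⟩ := hρ p.swap
    have h1 : g • p.swap = p := hg ▸ h
    have e1 : g • p.2 = p.1 := congrArg Prod.fst h1
    have e2 : g • p.1 = p.2 := congrArg Prod.snd h1
    have : g = 1 := hfree g p.1 p.2 hp.1 (by rw [e1, e2, Sym2.eq_swap])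
    rw [this, one_smul] at e1
    exact hp.1.ne e1.symm
  -- An arbitrary well-order selects one member of each pair `{p, τ p}`, giving one stable letter
  -- per unoriented orbit of edges in `N`.
  let R : V × V → V × V → Prop := WellOrderingRel
  let E : Type u := {p : V × V // p ∈ N ∧ R p (τ p)}
  have ht : ∀ e : E, ∃ t : G, t • τ e.1 = e.1.swap := by
    intro e
    obtain ⟨g, hg⟩ := hρ e.1.swap
    refine ⟨g⁻¹, ?_⟩
    change g⁻¹ • ρ e.1.swap = _
    rw [hg, inv_smul_smul]
  choose t ht using ht
  let ι : Type u := D ⊕ E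
  let H : ι → Subgroup G := Sum.elim (fun d => MulAction.stabilizer G (d : V))
    (fun e => Subgroup.zpowers (t e))
  -- Distributes the edges that leave `D` among the factors: nonstandard edges at `d` go to the
  -- stabilizer of `d`, and a standard edge `p` goes with `τ p` to their stable letter. The
  -- ping-pong set of a factor is the union of the half-spaces in front of its edges.
  let C : ι → V × V → Prop := Sum.elim (fun d p => p.1 = d ∧ ρ p ≠ p)
    (fun e p => p = e.1 ∨ p = τ e.1)
  let X : ι → Set V := fun i =>
    {z | ∃ v y, v ∈ D ∧ y ∉ D ∧ T.Adj v y ∧ C i (v, y) ∧ z ∈ T.halfSpace v y}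
  have hCdisj : ∀ i j p, C i p → C j p → i = j := by
    rintro (d | e) (d' | e') p hi hj
    · exact congrArg Sum.inl (Subtype.ext (hi.1.symm.trans hj.1))
    · rcases hj with rfl | rfl
      · exact absurd e'.2.1.2.1 hi.2
      · exact absurd (hτN _ e'.2.1).2.1 hi.2
    · rcases hi with rfl | rfl
      · exact absurd e.2.1.2.1 hj.2
      · exact absurd (hτN _ e.2.1).2.1 hj.2
    · refine congrArg Sum.inr (Subtype.ext ?_)
      rcases hi with rfl | rfl <;> rcases hj with hj | hj
      · exact hj
      · have h1 : τ e.1 = e'.1 := by rw [hj, hττ _ e'.2.1]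
        have h2 := e.2.2
        have h3 := e'.2.2
        rw [h1] at h2
        rw [← hj] at h3
        exact absurd h3 (asymm h2)
      · have h1 : τ e'.1 = e.1 := by rw [← hj, hττ _ e.2.1]
        have h2 := e.2.2
        have h3 := e'.2.2
        rw [hj] at h2
        rw [h1] at h3
        exact absurd h3 (asymm h2)
      · rw [← hττ _ e.2.1, hj, hττ _ e'.2.1]
  have hXD : ∀ i, ∀ d ∈ D, d ∉ X i := by
    rintro i d hd ⟨v, y, hv, hy, h, -, hz⟩
    exact hD hv hy h d hd hz
  have hXN : ∀ i, ∀ z ∈ X i, ∀ v y, v ∈ D → y ∉ D → T.Adj v y → z ∈ T.halfSpace v y →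
      C i (v, y) := by
    rintro i z ⟨v', y', hv', hy', h', hC, hz'⟩ v y hv hy h hz
    obtain ⟨rfl, rfl⟩ := hD.eq_of_mem hT.isAcyclic hv hy h hv' hy' h' hz hz'
    exact hC
  -- ping-pong for the vertex groups
  have hpp1 : ∀ d : D, ∀ h : G, h • (d : V) = d → h ≠ 1 → ∀ z : V, z ≠ d →
      (z ∈ D ∨ ∃ j, j ≠ Sum.inl d ∧ z ∈ X j) → h • z ∈ X (Sum.inl d) := by
    intro d h hh hne z hzd hz
    obtain ⟨v, y, hv, hy, hadj, hzy⟩ := IsGeodesicallyClosed.exists_mem_halfSpace hT.connected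
      (D := {(d : V)}) rfl (z := z) (by simpa using hzd)
    obtain rfl : v = d := hv
    -- The edge from `d` towards `z` stays in `D` or belongs to a factor other than that of `d`; in
    -- both cases it is standard. A nontrivial `h` must then move it to a nonstandard edge of the
    -- same orbit.
    have hstd : ρ (↑d, y) = (↑d, y) := by
      by_cases hyD : y ∈ D
      · exact hstdD _ d.2 hyD
      · rcases hz with hz | ⟨j, hj, hz⟩
        · exact absurd hzy (hD d.2 hyD hadj z hz)
        · have hCj := hXN j z hz d y d.2 hyD hadj hzy
          by_contra hns
          exact hj (hCdisj j (Sum.inl d) _ hCj ⟨rfl, hns⟩)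
    have hns : ρ (↑d, h • y) ≠ (↑d, h • y) := by
      intro h2
      refine hne (hfix h (↑d, y) hadj hstd ?_)
      have : h • ((d : V), y) = (↑d, h • y) := Prod.ext hh rfl
      rw [this, h2]
    have hadj' := hinv h _ _ hadj
    have hz' := smul_mem_halfSpace hinv h hzy
    rw [hh] at hadj' hz'
    refine ⟨d, h • y, d.2, fun hyD => hns (hstdD _ d.2 hyD), hadj', ⟨rfl, hns⟩, hz'⟩
  -- ping-pong for the stable letters
  have hpp2 : ∀ e : E, ∀ h ∈ Subgroup.zpowers (t e), h ≠ 1 → ∀ z,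
      (z ∈ D ∨ ∃ j, j ≠ Sum.inr e ∧ z ∈ X j) → h • z ∈ X (Sum.inr e) := by
    rintro e h ⟨n, rfl⟩ hne z hz
    have hp := e.2.1
    have hq := hτN _ hp
    set p := e.1 with hpdef
    set q := τ p with hqdef
    have hzp : z ∉ T.halfSpace p.1 p.2 := by
      rcases hz with hz | ⟨j, hj, hz⟩
      · exact hD (hN1 _ hp) hp.2.2 hp.1 z hz
      · intro hz'
        exact hj (hCdisj j (Sum.inr e) _
          (hXN j z hz _ _ (hN1 _ hp) hp.2.2 hp.1 hz') (Or.inl rfl))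
    have hzq : z ∉ T.halfSpace q.1 q.2 := by
      rcases hz with hz | ⟨j, hj, hz⟩
      · exact hD (hN1 _ hq) hq.2.2 hq.1 z hz
      · intro hz'
        exact hj (hCdisj j (Sum.inr e) _
          (hXN j z hz _ _ (hN1 _ hq) hq.2.2 hq.1 hz') (Or.inr rfl))
    have hdisj : ∀ w, w ∈ T.halfSpace p.1 p.2 → w ∉ T.halfSpace q.1 q.2 := by
      intro w hw hw'
      have := hD.eq_of_mem hT.isAcyclic (hN1 _ hp) hp.2.2 hp.1 (hN1 _ hq) hq.2.2 hq.1 hw hw'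
      exact hτne p hp (Prod.ext this.1.symm this.2.symm)
    have e1 : t e • q.1 = p.2 := congrArg Prod.fst (ht e)
    have e2 : t e • q.2 = p.1 := congrArg Prod.snd (ht e)
    have f1 : (t e)⁻¹ • p.2 = q.1 := by rw [← e1, inv_smul_smul]
    have f2 : (t e)⁻¹ • p.1 = q.2 := by rw [← e2, inv_smul_smul]
    -- The stable letter carries `q` onto the reversal of `p`, hence everything behind `q` to the
    -- region in front of `p`. Its powers therefore play ping-pong with these two disjoint
    -- half-spaces.
    have hfwd : ∀ w, w ∉ T.halfSpace q.1 q.2 → t e • w ∈ T.halfSpace p.1 p.2 := by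
      intro w hw
      have := smul_mem_halfSpace hinv (t e) ((hT.connected.mem_halfSpace_or w).resolve_left hw)
      rwa [e1, e2] at this
    have hbwd : ∀ w, w ∉ T.halfSpace p.1 p.2 → (t e)⁻¹ • w ∈ T.halfSpace q.1 q.2 := by
      intro w hw
      have := smul_mem_halfSpace hinv (t e)⁻¹ ((hT.connected.mem_halfSpace_or w).resolve_left hw)
      rwa [f1, f2] at this
    have hpos : ∀ k : ℕ, t e ^ (k + 1) • z ∈ T.halfSpace p.1 p.2 := by
      intro k
      induction k with
      | zero => simpa using hfwd z hzq
      | succ k ih => rw [pow_succ', mul_smul]; exact hfwd _ (hdisj _ ih)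
    have hneg : ∀ k : ℕ, (t e)⁻¹ ^ (k + 1) • z ∈ T.halfSpace q.1 q.2 := by
      intro k
      induction k with
      | zero => simpa using hbwd z hzp
      | succ k ih => rw [pow_succ', mul_smul]; exact hbwd _ (fun h => hdisj _ h ih)
    rcases n with (_ | k) | k
    · simp at hne
    · refine ⟨p.1, p.2, hN1 _ hp, hp.2.2, hp.1, Or.inl rfl, ?_⟩
      simpa only [Int.ofNat_eq_natCast, zpow_natCast] using hpos k
    · refine ⟨q.1, q.2, hN1 _ hq, hq.2.2, hq.1, Or.inr rfl, ?_⟩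
      simpa only [zpow_negSucc, inv_pow] using hneg k
  refine ⟨ι, H, ⟨?_, ?_⟩, ?_⟩
  · refine lift_injective_of_ping_pong_basePoints H X
      (Sum.elim (fun d => (d : V)) (fun _ => x₀)) ?_ ?_ ?_
    · rintro (d | e) j
      · exact hXD j _ d.2
      · exact hXD j _ hx₀
    · rintro (d | e) j hij h hh hne z hz
      · exact hpp1 d h hh hne z (fun hzd => hXD j _ d.2 (hzd ▸ hz)) (Or.inr ⟨j, hij.symm, hz⟩)
      · exact hpp2 e h hh hne z (Or.inr ⟨j, hij.symm, hz⟩)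
    · rintro (d | e)
      · refine Or.inr ⟨fun h hh => hh, ?_⟩
        rintro (d' | e) hj h hh hne
        · refine hpp1 d' h hh hne d (fun hdd => hj ?_) (Or.inl d.2)
          exact congrArg Sum.inl (Subtype.ext hdd.symm)
        · exact hpp2 e h hh hne d (Or.inl d.2)
      · exact Or.inl fun h hh hne => hpp2 e h hh hne x₀ (Or.inl hx₀)
  · rw [← MonoidHom.range_eq_top]
    set M := (Monoid.CoprodI.lift fun i => (H i).subtype).range with hM
    have hHM : ∀ i, H i ≤ M := by
      intro i h hh
      exact ⟨Monoid.CoprodI.of (i := i) ⟨h, hh⟩, by simp⟩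
    -- Induction along a path: a vertex stabilizer makes the next edge standard, and if that edge
    -- leaves `D`, a stable letter or its inverse brings its far end back into `D`. With `z` a
    -- translate of `x₀`, this gives surjectivity up to the stabilizer of `x₀`.
    have hreach : ∀ z, ∃ m ∈ M, m • z ∈ D := by
      intro z
      refine (hT.connected.preconnected x₀ z).induction_on (P := fun z => ∃ m ∈ M, m • z ∈ D)
        ⟨1, M.one_mem, by rwa [one_smul]⟩ ?_
      rintro a b hab ⟨m, hm, ha⟩
      have hadj := hinv m _ _ hab
      obtain ⟨h, hh, hρh⟩ := hstab (m • a) (m • b) ha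
      have hhM : h * m ∈ M := M.mul_mem (hHM (Sum.inl ⟨m • a, ha⟩) hh) hm
      by_cases hbD : h • m • b ∈ D
      · exact ⟨h * m, hhM, by rwa [mul_smul]⟩
      have hadj' := hinv h _ _ hadj
      rw [hh] at hadj'
      have hpN : (m • a, h • m • b) ∈ N := by
        refine ⟨hadj', ?_, hbD⟩
        rw [← hρh]
        obtain ⟨g, hg⟩ := hρ (m • a, m • b)
        rw [hg, hρinv, hg]
      set p : V × V := (m • a, h • m • b) with hpdef
      rcases trichotomous_of R p (τ p) with hR | hR | hR
      · refine ⟨(t ⟨p, hpN, hR⟩)⁻¹ * (h * m), M.mul_mem (M.inv_mem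
          (hHM (Sum.inr ⟨p, hpN, hR⟩) (Subgroup.mem_zpowers _))) hhM, ?_⟩
        have e1 : t ⟨p, hpN, hR⟩ • (τ p).1 = h • m • b := congrArg Prod.fst (ht ⟨p, hpN, hR⟩)
        rw [mul_smul, mul_smul, ← e1, inv_smul_smul]
        exact hρ1 _
      · exact absurd hR.symm (hτne p hpN)
      · have hR' : R (τ p) (τ (τ p)) := by rwa [hττ p hpN]
        let e : E := ⟨τ p, hτN p hpN, hR'⟩
        refine ⟨t e * (h * m), M.mul_mem
          (hHM (Sum.inr e) (Subgroup.mem_zpowers _)) hhM, ?_⟩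
        have e1 := ht e
        have e2 : τ e.1 = p := hττ p hpN
        rw [e2] at e1
        have e3 : t e • (h • m • b) = e.1.1 := congrArg Prod.snd e1
        rw [mul_smul, mul_smul, e3]
        exact hρ1 _
    rw [eq_top_iff]
    intro g _
    obtain ⟨m, hm, hmg⟩ := hreach (g • x₀)
    rw [← mul_smul] at hmg
    have h1 : m * g ∈ M := hHM (Sum.inl ⟨x₀, hx₀⟩) (hDinj x₀ hx₀ _ hmg)
    simpa using M.mul_mem (M.inv_mem hm) h1
  · rintro (d | e)
    · exact Or.inl ⟨d, rfl⟩
    · right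
      change IsCyclic (Subgroup.zpowers (t e))
      infer_instance

end BassSerre

/-! ### Collapsing the edges with nontrivial stabilizer -/

section Collapse

open SimpleGraph

variable {V : Type*} (G : Type*) [Group G] [MulAction G V]

/-- The subgraph of the edges that are fixed by some nontrivial group element. -/
def fixedEdgeGraph (T : SimpleGraph V) : SimpleGraph V where
  Adj x y := T.Adj x y ∧ ∃ g : G, g ≠ 1 ∧ g • x = x ∧ g • y = y
  symm := ⟨fun _ _ ⟨h, g, hg, h1, h2⟩ => ⟨h.symm, g, hg, h2, h1⟩⟩
  loopless := ⟨fun _ h => h.1.ne rfl⟩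

variable {G} {T : SimpleGraph V}

lemma fixedEdgeGraph_smul (hinv : ∀ (g : G) (x y : V), T.Adj x y → T.Adj (g • x) (g • y))
    (g : G) {x y : V} (h : (fixedEdgeGraph G T).Adj x y) :
    (fixedEdgeGraph G T).Adj (g • x) (g • y) := by
  obtain ⟨h, k, hk, h1, h2⟩ := h
  refine ⟨hinv g x y h, g * k * g⁻¹, by simpa [mul_inv_eq_one] using hk, ?_, ?_⟩
  · rw [mul_smul, mul_smul, inv_smul_smul, h1]
  · rw [mul_smul, mul_smul, inv_smul_smul, h2]

/-- The action on the components of the graph of fixed edges. -/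
@[reducible] def fixedEdgeComponentAction
    (hinv : ∀ (g : G) (x y : V), T.Adj x y → T.Adj (g • x) (g • y)) :
    MulAction G (fixedEdgeGraph G T).ConnectedComponent where
  smul g C := C.map ⟨fun x => g • x, fixedEdgeGraph_smul hinv g⟩
  one_smul C := by
    induction C using ConnectedComponent.ind with
    | h v => exact congrArg (connectedComponentMk _) (one_smul G v)
  mul_smul g h C := by
    induction C using ConnectedComponent.ind with
    | h v => exact congrArg (connectedComponentMk _) (mul_smul g h v)

/-- The graph obtained from `T` by collapsing the components of `F`. -/
def collapsedGraph (T F : SimpleGraph V) : SimpleGraph F.ConnectedComponent where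
  Adj C D := C ≠ D ∧ ∃ x y, F.connectedComponentMk x = C ∧ F.connectedComponentMk y = D ∧ T.Adj x y
  symm := ⟨fun _ _ ⟨h, x, y, hx, hy, hxy⟩ => ⟨h.symm, y, x, hy, hx, hxy.symm⟩⟩
  loopless := ⟨fun _ h => h.1 rfl⟩

variable {F : SimpleGraph V}

lemma le_deleteEdges_of_mk_ne (hF : F ≤ T) {x y : V}
    (hne : F.connectedComponentMk x ≠ F.connectedComponentMk y) : F ≤ T.deleteEdges {s(x, y)} := by
  intro a b hab
  rw [deleteEdges_adj]
  refine ⟨hF hab, fun h => hne ?_⟩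
  rcases Sym2.eq_iff.1 h with ⟨rfl, rfl⟩ | ⟨rfl, rfl⟩
  · exact ConnectedComponent.sound hab.reachable
  · exact ConnectedComponent.sound hab.symm.reachable

/-- Bridges stay bridges: a path in the collapsed graph that avoids an edge lifts to `T` without
that edge, because components of `F` remain connected there. -/
lemma collapsedGraph_isTree (hT : T.IsTree) (hF : F ≤ T) : (collapsedGraph T F).IsTree := by
  have := hT.connected.nonempty
  refine ⟨⟨fun C D => ?_⟩, ?_⟩
  · induction C using ConnectedComponent.ind with
    | h x =>
    induction D using ConnectedComponent.ind with
    | h y =>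
    refine (hT.connected.preconnected x y).induction_on
      (P := fun y => (collapsedGraph T F).Reachable (F.connectedComponentMk x)
        (F.connectedComponentMk y)) (Reachable.refl _) ?_
    intro a b hab ha
    by_cases h : F.connectedComponentMk a = F.connectedComponentMk b
    · rwa [← h]
    · exact ha.trans (Adj.reachable ⟨h, a, b, rfl, rfl, hab⟩)
  · rw [isAcyclic_iff_forall_adj_isBridge]
    rintro C D ⟨hne, x, y, rfl, rfl, hxy⟩
    rw [isBridge_iff]
    intro hreach
    have hbr := isAcyclic_iff_forall_adj_isBridge.1 hT.isAcyclic hxy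
    rw [isBridge_iff] at hbr
    have hle := le_deleteEdges_of_mk_ne hF hne
    refine hbr (hreach.induction_on
      (P := fun E => ∀ z, F.connectedComponentMk z = E → (T.deleteEdges {s(x, y)}).Reachable x z)
      ?_ ?_ y rfl)
    · intro z hz
      exact (ConnectedComponent.exact hz.symm).mono hle
    · intro E E' hE ih z hz
      rw [deleteEdges_adj] at hE
      obtain ⟨⟨-, a, b, ha, hb, hab⟩, hE⟩ := hE
      have hab' : (T.deleteEdges {s(x, y)}).Adj a b := by
        rw [deleteEdges_adj]
        refine ⟨hab, fun h => hE ?_⟩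
        rw [← ha, ← hb]
        rcases Sym2.eq_iff.1 h with ⟨rfl, rfl⟩ | ⟨rfl, rfl⟩
        · rfl
        · exact Sym2.eq_swap
      exact ((ih a ha).trans hab'.reachable).trans
        ((ConnectedComponent.exact (hb.trans hz.symm)).mono hle)

/-- A second edge between the same two components would close a cycle. Hence an element that fixes a
collapsed edge fixes the edge of `T` below it. -/
lemma eq_of_adj_of_mk_eq (hT : T.IsAcyclic) (hF : F ≤ T) {x y a b : V} (hxy : T.Adj x y)
    (hab : T.Adj a b) (hne : F.connectedComponentMk x ≠ F.connectedComponentMk y)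
    (ha : F.connectedComponentMk a = F.connectedComponentMk x)
    (hb : F.connectedComponentMk b = F.connectedComponentMk y) : a = x ∧ b = y := by
  have hbr := isAcyclic_iff_forall_adj_isBridge.1 hT hxy
  rw [isBridge_iff] at hbr
  have hle := le_deleteEdges_of_mk_ne hF hne
  by_cases h : s(a, b) = s(x, y)
  · rcases Sym2.eq_iff.1 h with h | ⟨rfl, rfl⟩
    · exact h
    · exact absurd hb hne
  · refine absurd ?_ hbr
    refine (((ConnectedComponent.exact ha).mono hle).symm.trans (Adj.reachable ?_)).trans
      ((ConnectedComponent.exact hb).mono hle)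
    rw [deleteEdges_adj]
    exact ⟨hab, h⟩

end Collapse

/-- A group without elements of order two that acts on a tree is a free product of
stabilizers of components of the graph of fixed edges and of cyclic groups. -/
theorem exists_isFreeProductOf_stabilizer_fixedEdge_component {G V : Type u} [Group G]
    [MulAction G V] {T : SimpleGraph V} (hT : T.IsTree)
    (hinv : ∀ (g : G) (x y : V), T.Adj x y → T.Adj (g • x) (g • y))
    (htwo : ∀ g : G, g ^ 2 = 1 → g = 1) :
    ∃ (ι : Type u) (H : ι → Subgroup G), IsFreeProductOf H ∧
      ∀ i, (∃ x : V, ∀ g ∈ H i, (fixedEdgeGraph G T).Reachable x (g • x)) ∨ IsCyclic (H i) := by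
  set F := fixedEdgeGraph G T with hFdef
  have hF : F ≤ T := fun x y h => h.1
  let := fixedEdgeComponentAction (G := G) hinv
  have hmk : ∀ (g : G) (x : V), g • F.connectedComponentMk x = F.connectedComponentMk (g • x) :=
    fun _ _ => rfl
  obtain ⟨ι, H, hH, hst⟩ := exists_isFreeProductOf_of_isTree (G := G)
    (collapsedGraph_isTree hT hF) (by
      rintro g C D ⟨hne, x, y, rfl, rfl, hxy⟩
      exact ⟨(MulAction.injective g).ne hne, g • x, g • y, rfl, rfl, hinv g x y hxy⟩) (by
      rintro g C D ⟨hne, x, y, rfl, rfl, hxy⟩ hg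
      have hfixed : ∀ k : G, k • x = x → k • y = y → k = 1 := by
        intro k h1 h2
        by_contra hk
        exact hne (SimpleGraph.ConnectedComponent.sound
          (SimpleGraph.Adj.reachable ⟨hxy, k, hk, h1, h2⟩))
      rw [hmk, hmk] at hg
      rcases Sym2.eq_iff.1 hg with ⟨h1, h2⟩ | ⟨h1, h2⟩
      · obtain ⟨h3, h4⟩ := eq_of_adj_of_mk_eq hT.isAcyclic hF hxy (hinv g x y hxy) hne h1 h2
        exact hfixed g h3 h4
      · obtain ⟨h3, h4⟩ := eq_of_adj_of_mk_eq hT.isAcyclic hF hxy (hinv g x y hxy).symm hne h2 h1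
        -- An inversion squares into the stabilizer of the edge, which is trivial because the edge
        -- was not collapsed.
        refine htwo g (hfixed _ ?_ ?_)
        · rw [pow_two, mul_smul, h4, h3]
        · rw [pow_two, mul_smul, h3, h4])
  refine ⟨ι, H, hH, fun i => (hst i).imp ?_ id⟩
  rintro ⟨C, hC⟩
  induction C using SimpleGraph.ConnectedComponent.ind with
  | h x =>
  refine ⟨x, fun g hg => ?_⟩
  rw [hC, MulAction.mem_stabilizer_iff, hmk] at hg
  exact (SimpleGraph.ConnectedComponent.exact hg).symm

/-! ### Two-by-two matrices and commutation in `PSL₂` -/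

section TwoByTwo

variable {K : Type*} [Field K]

/-- A nonscalar `2 × 2` matrix generates its centralizer as an algebra. The coefficient `y` is read
off from a nonzero off-diagonal entry or, for diagonal `A`, from the difference of the diagonal
entries. -/
lemma Matrix.exists_eq_smul_one_add_smul_of_commute {A B : Matrix (Fin 2) (Fin 2) K}
    (hA : ∀ c : K, A ≠ c • 1) (h : A * B = B * A) : ∃ x y : K, B = x • 1 + y • A := by
  have h00 := congrFun (congrFun h 0) 0
  have h01 := congrFun (congrFun h 0) 1
  have h10 := congrFun (congrFun h 1) 0
  simp only [Matrix.mul_apply, Fin.sum_univ_two] at h00 h01 h10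
  by_cases hb : A 0 1 = 0
  · by_cases hc : A 1 0 = 0
    · have had : A 0 0 - A 1 1 ≠ 0 := by
        intro had
        refine hA (A 0 0) ?_
        ext i j
        fin_cases i <;> fin_cases j <;> simp [hb, hc, sub_eq_zero.1 had]
      have hB01 : B 0 1 = 0 := by
        refine (mul_eq_zero.1 (?_ : (A 0 0 - A 1 1) * B 0 1 = 0)).resolve_left had
        rw [hb] at h01; linear_combination h01
      have hB10 : B 1 0 = 0 := by
        refine (mul_eq_zero.1 (?_ : (A 0 0 - A 1 1) * B 1 0 = 0)).resolve_left had
        rw [hc] at h10; linear_combination -h10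
      refine ⟨B 0 0 - (B 0 0 - B 1 1) / (A 0 0 - A 1 1) * A 0 0,
        (B 0 0 - B 1 1) / (A 0 0 - A 1 1), ?_⟩
      ext i j
      fin_cases i <;> fin_cases j <;> simp [hb, hc, hB01, hB10]
      field_simp
      ring
    · refine ⟨B 0 0 - B 1 0 / A 1 0 * A 0 0, B 1 0 / A 1 0, ?_⟩
      ext i j
      fin_cases i <;> fin_cases j <;> simp [hc]
      · field_simp; linear_combination -h00
      · field_simp; linear_combination -h10
  · refine ⟨B 0 0 - B 0 1 / A 0 1 * A 0 0, B 0 1 / A 0 1, ?_⟩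
    ext i j
    fin_cases i <;> fin_cases j <;> simp [hb]
    · field_simp; linear_combination h00
    · field_simp; linear_combination h01

lemma Matrix.commute_of_commute_of_ne_smul_one {A B C : Matrix (Fin 2) (Fin 2) K}
    (hA : ∀ c : K, A ≠ c • 1) (hB : A * B = B * A) (hC : A * C = C * A) : B * C = C * B := by
  obtain ⟨x, y, rfl⟩ := Matrix.exists_eq_smul_one_add_smul_of_commute hA hB
  simp [add_mul, mul_add, hC]

lemma Matrix.mul_self_fin_two (A : Matrix (Fin 2) (Fin 2) K) :
    A * A = A.trace • A - A.det • 1 := by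
  ext i j
  fin_cases i <;> fin_cases j <;>
    simp [Matrix.mul_apply, Fin.sum_univ_two, Matrix.trace_fin_two, Matrix.det_fin_two] <;> ring

lemma Matrix.det_smul_one_add_smul (x y : K) (A : Matrix (Fin 2) (Fin 2) K) :
    (x • 1 + y • A).det = x ^ 2 + x * y * A.trace + y ^ 2 * A.det := by
  simp [Matrix.det_fin_two, Matrix.trace_fin_two]; ring

lemma Matrix.trace_smul_one_add_smul (x y : K) (A : Matrix (Fin 2) (Fin 2) K) :
    (x • 1 + y • A).trace = 2 * x + y * A.trace := by
  simp [Matrix.trace_fin_two]; ring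

end TwoByTwo

namespace Matrix.ProjectiveSpecialLinearGroup

variable {K : Type*} [Field K]

lemma mk_eq_mk_iff (A B : SL(2, K)) : (QuotientGroup.mk A : PSL(2, K)) = QuotientGroup.mk B ↔
    A = B ∨ A = -B := by
  rw [QuotientGroup.eq, Matrix.SpecialLinearGroup.mem_center_iff]
  constructor
  · rintro ⟨r, hr, h⟩
    have hr' : r = 1 ∨ r = -1 := mul_self_eq_one_iff.1 (by simpa [pow_two] using hr)
    have h2 : (B : Matrix (Fin 2) (Fin 2) K) = A * (A⁻¹ * B : SL(2, K)) := by
      rw [← Matrix.SpecialLinearGroup.coe_mul, mul_inv_cancel_left]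
    rw [← h] at h2
    rcases hr' with rfl | rfl
    · left; ext i j; simp [h2]
    · right; ext i j; simp [h2]
  · rintro (rfl | rfl)
    · exact ⟨1, by simp, by simp⟩
    · exact ⟨-1, by simp, by ext i j; fin_cases i <;> fin_cases j <;> simp⟩


lemma mk_eq_one_iff (A : SL(2, K)) : (QuotientGroup.mk A : PSL(2, K)) = 1 ↔ A = 1 ∨ A = -1 :=
  mk_eq_mk_iff A 1

lemma ne_smul_one_of_mk_ne_one {A : SL(2, K)} (hA : (QuotientGroup.mk A : PSL(2, K)) ≠ 1) (c : K) :
    (A : Matrix (Fin 2) (Fin 2) K) ≠ c • 1 := by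
  intro h
  have hdet := A.det_coe
  rw [h, Matrix.det_smul, Matrix.det_one, mul_one, Fintype.card_fin, pow_two,
    mul_self_eq_one_iff] at hdet
  refine hA ((mk_eq_one_iff A).2 (hdet.imp ?_ ?_))
  · rintro rfl; ext i j; simp [h]
  · rintro rfl; ext i j; simp [h]

lemma mul_self_eq (A : SL(2, K)) : (A : Matrix (Fin 2) (Fin 2) K) * A =
    (A : Matrix (Fin 2) (Fin 2) K).trace • (A : Matrix (Fin 2) (Fin 2) K) - 1 := by
  rw [Matrix.mul_self_fin_two, A.det_coe, one_smul]

variable [CharZero K]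

/-- The lifts commute up to sign. If they anticommuted, `A` would be conjugate to `-A`, so its trace
would vanish and Cayley–Hamilton would give `A ^ 2 = -1`. -/
lemma mul_comm_of_commute_mk {A B : SL(2, K)} (hA : (QuotientGroup.mk A : PSL(2, K)) ^ 2 ≠ 1)
    (h : Commute (QuotientGroup.mk A : PSL(2, K)) (QuotientGroup.mk B)) : A * B = B * A := by
  refine ((mk_eq_mk_iff (A * B) (B * A)).1 h).resolve_right fun hneg => hA ?_
  have h1 : A = -(B * A * B⁻¹) := by
    rw [← neg_mul, ← hneg, mul_inv_cancel_right]
  have h2 : (A : Matrix (Fin 2) (Fin 2) K).trace = -(A : Matrix (Fin 2) (Fin 2) K).trace := by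
    conv_lhs => rw [h1]
    rw [Matrix.SpecialLinearGroup.coe_neg, Matrix.trace_neg, mul_assoc,
      Matrix.SpecialLinearGroup.coe_mul, Matrix.trace_mul_comm, ← Matrix.SpecialLinearGroup.coe_mul,
      inv_mul_cancel_right]
  have h3 := mul_self_eq A
  rw [self_eq_neg.1 h2, zero_smul, zero_sub] at h3
  change (QuotientGroup.mk (A ^ 2) : PSL(2, K)) = 1
  rw [mk_eq_one_iff, pow_two]
  right
  exact Subtype.ext (by simpa using h3)

lemma commute_of_commute {a b c : PSL(2, K)} (ha : a ^ 2 ≠ 1) (hb : Commute a b)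
    (hc : Commute a c) : Commute b c := by
  induction a using QuotientGroup.induction_on with | H A =>
  induction b using QuotientGroup.induction_on with | H B =>
  induction c using QuotientGroup.induction_on with | H C =>
  have h1 := congrArg Subtype.val (mul_comm_of_commute_mk ha hb)
  have h2 := congrArg Subtype.val (mul_comm_of_commute_mk ha hc)
  have hA : (QuotientGroup.mk A : PSL(2, K)) ≠ 1 := fun h => ha (by rw [h, one_pow])
  have h3 := Matrix.commute_of_commute_of_ne_smul_one (ne_smul_one_of_mk_ne_one hA)
    (by simpa using h1) (by simpa using h2)
  have h4 : B * C = C * B := Subtype.ext (by simpa using h3)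
  exact congrArg (QuotientGroup.mk (s := Subgroup.center SL(2, K))) h4

/-- Such an `A` is unipotent, so its powers are `1 + k (A - 1)`; in characteristic zero none with `k
> 0` is scalar unless `A` is. -/
lemma mk_eq_one_of_trace_eq_two {A : SL(2, K)}
    (hfin : IsOfFinOrder (QuotientGroup.mk A : PSL(2, K)))
    (h : (A : Matrix (Fin 2) (Fin 2) K).trace = 2) : (QuotientGroup.mk A : PSL(2, K)) = 1 := by
  obtain ⟨n, hn, h1⟩ := isOfFinOrder_iff_pow_eq_one.1 hfin
  have h2 : A ^ n = 1 ∨ A ^ n = -1 := (mk_eq_one_iff _).1 h1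
  have hpow : ∀ k : ℕ, (A : Matrix (Fin 2) (Fin 2) K) ^ k = (1 - k : K) • 1 + (k : K) • A.1 := by
    intro k
    induction k with
    | zero => simp
    | succ k ih =>
      rw [pow_succ, ih, add_mul, smul_mul_assoc, smul_mul_assoc, mul_self_eq, h, one_mul]
      push_cast
      module
  by_contra hA
  have hns := ne_smul_one_of_mk_ne_one hA
  have h3 : ∃ c : K, (A : Matrix (Fin 2) (Fin 2) K) ^ n = c • 1 := by
    rcases h2 with h2 | h2
    · exact ⟨1, by rw [← Matrix.SpecialLinearGroup.coe_pow, h2]; simp⟩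
    · exact ⟨-1, by rw [← Matrix.SpecialLinearGroup.coe_pow, h2]; simp⟩
  obtain ⟨c, hc⟩ := h3
  rw [hpow] at hc
  have hn0 : (n : K) ≠ 0 := by exact_mod_cast hn.ne'
  refine hns ((n : K)⁻¹ * (c - (1 - n))) ?_
  rw [mul_smul, sub_smul, ← hc, add_sub_cancel_left, smul_smul, inv_mul_cancel₀ hn0, one_smul]

/-- Nontrivial torsion elements have distinct eigenvalues: this is the discriminant of the
characteristic polynomial. Trace `-2` reduces to trace `2` by changing the sign of the lift. -/
lemma trace_sq_ne_four {A : SL(2, K)} (hfin : IsOfFinOrder (QuotientGroup.mk A : PSL(2, K)))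
    (h1 : (QuotientGroup.mk A : PSL(2, K)) ≠ 1) :
    (A : Matrix (Fin 2) (Fin 2) K).trace ^ 2 ≠ 4 := by
  intro h
  have h2 : ((A : Matrix (Fin 2) (Fin 2) K).trace - 2) *
      ((A : Matrix (Fin 2) (Fin 2) K).trace + 2) = 0 := by linear_combination h
  rcases mul_eq_zero.1 h2 with h2 | h2
  · exact h1 (mk_eq_one_of_trace_eq_two hfin (sub_eq_zero.1 h2))
  · have h3 : (QuotientGroup.mk (-A) : PSL(2, K)) = QuotientGroup.mk A :=
      (mk_eq_mk_iff _ _).2 (Or.inr rfl)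
    rw [← h3] at hfin h1
    refine h1 (mk_eq_one_of_trace_eq_two hfin ?_)
    rw [Matrix.SpecialLinearGroup.coe_neg, Matrix.trace_neg]
    linear_combination -h2

/-- The conjugate has the form `x + y A` with the trace and determinant of `A`. As the discriminant
is nonzero, these two equations force `y = 1` or `y = -1`, giving `A` or `t - A = A⁻¹`. -/
lemma conj_eq_or_eq_inv_of_commute {a g : PSL(2, K)} (ha : a ^ 2 ≠ 1) (hfin : IsOfFinOrder a)
    (h : Commute a (g * a * g⁻¹)) : g * a * g⁻¹ = a ∨ g * a * g⁻¹ = a⁻¹ := by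
  induction a using QuotientGroup.induction_on with | H A =>
  induction g using QuotientGroup.induction_on with | H P =>
  have hA : (QuotientGroup.mk A : PSL(2, K)) ≠ 1 := fun h => ha (by rw [h, one_pow])
  have h1 : A * (P * A * P⁻¹) = (P * A * P⁻¹) * A := mul_comm_of_commute_mk ha h
  have hns := ne_smul_one_of_mk_ne_one hA
  obtain ⟨x, y, hxy⟩ := Matrix.exists_eq_smul_one_add_smul_of_commute hns
    (B := (P * A * P⁻¹ : SL(2, K))) (by simpa using congrArg Subtype.val h1)
  set t := (A : Matrix (Fin 2) (Fin 2) K).trace with ht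
  have htr : 2 * x + y * t = t := by
    rw [ht, ← Matrix.trace_smul_one_add_smul, ← hxy, Matrix.SpecialLinearGroup.coe_mul,
      Matrix.trace_mul_comm, ← Matrix.SpecialLinearGroup.coe_mul, inv_mul_cancel_left]
  have hdet : x ^ 2 + x * y * t + y ^ 2 = 1 := by
    have := (P * A * P⁻¹ : SL(2, K)).det_coe
    rwa [hxy, Matrix.det_smul_one_add_smul, A.det_coe, mul_one] at this
  have ht4 : t ^ 2 - 4 ≠ 0 := sub_ne_zero.2 (trace_sq_ne_four hfin hA)
  have hy : (y - 1) * (y + 1) = 0 := by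
    refine (mul_eq_zero.1 (?_ : (t ^ 2 - 4) * ((y - 1) * (y + 1)) = 0)).resolve_left ht4
    linear_combination (-4) * hdet + (2 * x + y * t + t) * htr
  have hx : x = (t - y * t) / 2 := by field_simp; linear_combination htr
  rcases mul_eq_zero.1 hy with hy | hy
  · left
    have hy1 : y = 1 := by linear_combination hy
    have hx0 : x = 0 := by rw [hx, hy1]; ring
    rw [hy1, hx0, zero_smul, zero_add, one_smul] at hxy
    exact congrArg (QuotientGroup.mk (s := Subgroup.center SL(2, K))) (Subtype.ext hxy)
  · right
    have hy1 : y = -1 := by linear_combination hy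
    have hx0 : x = t := by rw [hx, hy1]; ring
    have : P * A * P⁻¹ = A⁻¹ := by
      rw [eq_inv_iff_mul_eq_one]
      refine Subtype.ext ?_
      rw [Matrix.SpecialLinearGroup.coe_mul, hxy, hy1, hx0, add_mul, smul_mul_assoc, smul_mul_assoc,
        mul_self_eq, one_mul, ← ht]
      simp
    exact congrArg (QuotientGroup.mk (s := Subgroup.center SL(2, K))) this

end Matrix.ProjectiveSpecialLinearGroup

/-! ### Finite subgroups without elements of order two -/

section OddOrder

variable {K : Type*} [Field K] [CharZero K]

/-- Two-dimensional unimodular representations of groups of odd order have commutative image. -/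
theorem Matrix.SpecialLinearGroup.map_mul_comm_of_odd_card {H : Type*} [Group H] [Finite H]
    (hodd : Odd (Nat.card H)) (φ : H →* SL(2, K)) (a b : H) : φ a * φ b = φ b * φ a := by
  classical
  have := Fintype.ofFinite H
  let M : H → Matrix (Fin 2) (Fin 2) K := fun h => (φ h : Matrix (Fin 2) (Fin 2) K)
  have hM : ∀ g h, M (g * h) = M g * M h := fun g h => by
    simp only [M, map_mul, Matrix.SpecialLinearGroup.coe_mul]
  have hM1 : M 1 = 1 := by simp [M]
  by_contra hcon
  -- Schur's lemma in this setting: a nonscalar matrix commuting with the image would make the image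
  -- commutative.
  have hscalar : ∀ X : Matrix (Fin 2) (Fin 2) K, (∀ h, M h * X = X * M h) → ∃ c : K, X = c • 1 := by
    intro X hX
    by_contra! hne
    refine hcon (Subtype.ext ?_)
    rw [Matrix.SpecialLinearGroup.coe_mul, Matrix.SpecialLinearGroup.coe_mul]
    exact Matrix.commute_of_commute_of_ne_smul_one hne (hX a).symm (hX b).symm
  set n : K := (Nat.card H : K) with hn
  have hn0 : n ≠ 0 := by rw [hn]; exact_mod_cast Nat.card_pos.ne'
  let Φ : Matrix (Fin 2) (Fin 2) K → Matrix (Fin 2) (Fin 2) K := fun X => ∑ h, M h * X * M h⁻¹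
  have hΦ : ∀ X, Φ X = (n / 2 * X.trace) • 1 := by
    intro X
    obtain ⟨c, hc⟩ := hscalar (Φ X) (by
      intro g
      have h1 : M g * Φ X * M g⁻¹ = Φ X := by
        simp only [Φ, Finset.mul_sum, Finset.sum_mul]
        refine Fintype.sum_equiv (Equiv.mulLeft g) _ _ fun h => ?_
        rw [Equiv.coe_mulLeft, _root_.mul_inv_rev, hM, hM]
        simp only [mul_assoc]
      conv_rhs => rw [← h1]
      rw [mul_assoc, ← hM, inv_mul_cancel, hM1, mul_one])
    have htr : (Φ X).trace = n * X.trace := by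
      simp only [Φ, Matrix.trace_sum]
      rw [Finset.sum_congr rfl fun h _ => by
        rw [mul_assoc, Matrix.trace_mul_comm, mul_assoc, ← hM, inv_mul_cancel, hM1, mul_one]]
      simp [hn]
    rw [hc, Matrix.trace_smul, Matrix.trace_one] at htr
    rw [hc]
    congr 1
    simp at htr
    linear_combination htr / 2
  -- Orthogonality of characters, obtained by averaging the matrix units. The square appears because
  -- the inverse of a unimodular matrix is its adjugate and has the same trace.
  have hsq : ∑ h, (M h).trace ^ 2 = n := by
    have h1 : ∑ i, ∑ j, Φ (Matrix.single i j 1) i j = n := by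
      simp_rw [hΦ]
      simp [Fin.sum_univ_two]
    rw [← h1]
    have h2 : ∀ h : H, (M h).trace ^ 2 = ∑ i, ∑ j,
        (M h * Matrix.single i j (1 : K) * M h⁻¹ : Matrix (Fin 2) (Fin 2) K) i j := by
      intro h
      have h3 : M h⁻¹ = (M h).adjugate := by
        simp only [M, map_inv, Matrix.SpecialLinearGroup.coe_inv]
      rw [h3]
      simp [Matrix.mul_apply, Matrix.adjugate_fin_two, Fin.sum_univ_two, Matrix.trace_fin_two,
        Matrix.single]
      ring
    rw [Finset.sum_congr rfl fun h _ => h2 h, Finset.sum_comm]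
    refine Finset.sum_congr rfl fun i _ => ?_
    rw [Finset.sum_comm]
    refine Finset.sum_congr rfl fun j _ => ?_
    exact (Matrix.sum_apply i j _ _).symm
  -- Squaring permutes a group of odd order, and the trace of `h ^ 2` is the squared trace of `h`
  -- minus `2`; so the sum is `n - 2 n`.
  have htr : ∑ h, (M h).trace = -n := by
    have hcop : (Nat.card H).Coprime 2 := hodd.coprime_two_right
    have h1 : ∑ h, (M (h ^ 2)).trace = ∑ h, (M h).trace :=
      Fintype.sum_equiv (powCoprime hcop) _ _ fun h => rfl
    rw [← h1]
    have h2 : ∀ h, (M (h ^ 2)).trace = (M h).trace ^ 2 - 2 := by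
      intro h
      rw [pow_two, hM]
      simp only [M]
      rw [Matrix.ProjectiveSpecialLinearGroup.mul_self_eq, Matrix.trace_sub, Matrix.trace_smul,
        Matrix.trace_one]
      simp [pow_two]
    rw [Finset.sum_congr rfl fun h _ => h2 h, Finset.sum_sub_distrib, hsq]
    simp [← Nat.card_eq_fintype_card, ← hn]
    ring
  -- `S / n` is idempotent, yet its trace is `-1`, which is impossible in characteristic zero.
  -- Cayley–Hamilton makes `S` scalar and reduces this to arithmetic.
  set S : Matrix (Fin 2) (Fin 2) K := ∑ h, M h with hS
  have hStr : S.trace = -n := by rw [hS, Matrix.trace_sum, htr]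
  have hSS : S * S = n • S := by
    conv_lhs => lhs; rw [hS]
    rw [Finset.sum_mul, Finset.sum_congr rfl fun g _ => (by
      rw [hS, Finset.mul_sum]
      refine Fintype.sum_equiv (Equiv.mulLeft g) _ _ fun h => ?_
      rw [Equiv.coe_mulLeft, hM] : M g * S = S)]
    simp [hn, Nat.cast_smul_eq_nsmul]
  have hCH := Matrix.mul_self_fin_two S
  rw [hSS, hStr] at hCH
  have hSc : S = (-S.det / (2 * n)) • 1 := by
    have h1 : (2 * n) • S = (-S.det) • 1 := by
      rw [two_mul, add_smul]
      nth_rewrite 1 [hCH]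
      module
    rw [div_eq_inv_mul, mul_smul, ← h1, smul_smul, inv_mul_cancel₀ (by simpa using hn0), one_smul]
  set s := -S.det / (2 * n)
  have h2s : s * 2 = -n := by
    rw [← hStr, hSc, Matrix.trace_smul, Matrix.trace_one]; simp
  have hss : s * s = n * s := by
    have h1 := congrFun (congrFun hSS 0) 0
    rw [hSc] at h1
    simpa using h1
  have : s * (s - n) = 0 := by linear_combination hss
  rcases mul_eq_zero.1 this with h | h
  · rw [h, zero_mul] at h2s
    exact hn0 (neg_eq_zero.1 h2s.symm)
  · have h3 : 3 * n = 0 := by linear_combination h2s - 2 * h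
    exact hn0 (by simpa using h3)

/-- A finite subgroup of `PSL₂` over a field of characteristic zero without elements of order
two is commutative. -/
theorem Matrix.ProjectiveSpecialLinearGroup.commute_of_finite {Γ : Subgroup PSL(2, K)} [Finite Γ]
    (htwo : ∀ g ∈ Γ, g ^ 2 = 1 → g = 1) {a b : PSL(2, K)} (ha : a ∈ Γ) (hb : b ∈ Γ) :
    Commute a b := by
  have hodd : Odd (Nat.card Γ) := by
    rw [← Nat.not_even_iff_odd, even_iff_two_dvd]
    intro h
    obtain ⟨x, hx⟩ := exists_prime_orderOf_dvd_card' (G := Γ) 2 h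
    have h1 : x ^ 2 = 1 := orderOf_dvd_iff_pow_eq_one.1 hx.dvd
    have h2 := htwo x x.2 (by simpa using congrArg Subtype.val h1)
    have h3 : x = 1 := Subtype.ext h2
    rw [h3, orderOf_one] at hx
    omega
  let π : SL(2, K) →* PSL(2, K) := QuotientGroup.mk' _
  let Γ' := Γ.comap π
  let f : Γ' →* Γ := (π.comp Γ'.subtype).codRestrict Γ fun x => x.2
  have hf : Function.Surjective f := by
    rintro ⟨y, hy⟩
    obtain ⟨x, rfl⟩ := QuotientGroup.mk'_surjective _ y
    exact ⟨⟨x, hy⟩, rfl⟩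
  have hker : ∀ x ∈ f.ker, (x : SL(2, K)) = 1 ∨ (x : SL(2, K)) = -1 := by
    intro x hx
    exact (mk_eq_one_iff _).1 (congrArg Subtype.val hx)
  have hinj : Function.Injective
      (fun x : f.ker => (⟨(x : Γ'), hker x x.2⟩ : ({1, -1} : Set SL(2, K)))) := by
    intro x y hxy
    exact Subtype.ext (Subtype.ext (Subtype.mk.inj hxy))
  have hkerfin : Finite f.ker := by
    exact Finite.of_injective _ hinj
  have hindex : f.ker.index = Nat.card Γ := by
    rw [Subgroup.index_ker, MonoidHom.range_eq_top.2 hf]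
    exact Nat.card_congr Subgroup.topEquiv.toEquiv
  have hcard : Nat.card f.ker ∣ 2 := by
    have h2 : Nat.card f.ker ≤ 2 := by
      have : Nat.card f.ker ≤ Nat.card ({1, -1} : Set SL(2, K)) :=
        Nat.card_le_card_of_injective _ hinj
      refine this.trans ?_
      rw [Nat.card_coe_set_eq]
      exact (Set.ncard_insert_le _ _).trans (by rw [Set.ncard_singleton])
    have h3 : 0 < Nat.card f.ker := Nat.card_pos
    interval_cases Nat.card f.ker <;> norm_num
  have hcop : Nat.Coprime (Nat.card f.ker) f.ker.index := by
    rw [hindex]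
    exact Nat.Coprime.coprime_dvd_left hcard hodd.coprime_two_left
  -- Schur–Zassenhaus: the complement of the kernel `{±1} ∩ Γ'` has odd order and maps onto `Γ`, so
  -- the result for `SL₂` applies to it.
  obtain ⟨C, hC⟩ := Subgroup.exists_right_complement'_of_coprime hcop
  have hCcard : Nat.card C = Nat.card Γ := by
    rw [← hindex, hC.symm.index_eq_card]
  have hCfin : Finite C := Nat.finite_of_card_ne_zero (by rw [hCcard]; exact Nat.card_pos.ne')
  have hlift : ∀ g ∈ Γ, ∃ c : C, π (c : Γ') = g := by
    intro g hg
    obtain ⟨x, hx⟩ := hf ⟨g, hg⟩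
    obtain ⟨⟨k, c⟩, hkc⟩ := hC.2 x
    refine ⟨c, ?_⟩
    have h1 : f c = ⟨g, hg⟩ := by
      rw [← hx, ← hkc, map_mul, MonoidHom.mem_ker.1 k.2, one_mul]
    exact congrArg Subtype.val h1
  obtain ⟨x, rfl⟩ := hlift a ha
  obtain ⟨y, rfl⟩ := hlift b hb
  have := Matrix.SpecialLinearGroup.map_mul_comm_of_odd_card (hCcard ▸ hodd)
    (Γ'.subtype.comp C.subtype) x y
  exact (congrArg π this)

end OddOrder

/-! ### Commutative subgroups of `PSL₂` that commute with a torsion element -/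

/-- The image of `f` is infinite cyclic unless it is trivial, and a preimage of a generator splits
off from the kernel. -/
lemma isCyclic_or_isFiniteCyclicProdInfiniteCyclic {B : Type*} [Group B]
    (hcomm : ∀ x y : B, x * y = y * x) (f : B →* Multiplicative ℤ) (hfin : Finite f.ker)
    (hcyc : IsCyclic f.ker) : IsCyclic B ∨ IsFiniteCyclicProdInfiniteCyclic B := by
  by_cases htriv : f.ker = ⊤
  · left
    rw [htriv] at hcyc
    exact (Subgroup.topEquiv (G := B)).isCyclic.1 hcyc
  right
  obtain ⟨⟨_, b, rfl⟩, hb⟩ := IsCyclic.exists_generator (α := f.range)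
  have hgen : ∀ c : B, ∃ k : ℤ, f b ^ k = f c := by
    intro c
    obtain ⟨k, hk⟩ := hb ⟨f c, c, rfl⟩
    exact ⟨k, congrArg Subtype.val hk⟩
  have hb1 : f b ≠ 1 := by
    intro h
    refine htriv (eq_top_iff.2 fun c _ => ?_)
    obtain ⟨k, hk⟩ := hgen c
    rw [MonoidHom.mem_ker, ← hk, h, one_zpow]
  let ψ : f.ker × Multiplicative ℤ →* B :=
    MonoidHom.noncommCoprod f.ker.subtype (zpowersHom B b) fun _ _ => hcomm _ _
  have hψ : ∀ k (n : ℤ), ψ (k, Multiplicative.ofAdd n) = k * b ^ n := fun k n => rfl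
  have hψbij : Function.Bijective ψ := by
    constructor
    · rw [injective_iff_map_eq_one]
      rintro ⟨k, n⟩ h
      induction n using Multiplicative.rec with | _ n =>
      rw [hψ] at h
      have h1 : f b ^ n = 1 := by
        have := congrArg f h
        rwa [map_mul, MonoidHom.mem_ker.1 k.2, one_mul, map_zpow, map_one] at this
      have h2 : n = 0 := by
        have h3 : n * (f b).toAdd = 0 := by
          have := congrArg Multiplicative.toAdd h1
          simpa using this
        refine (mul_eq_zero.1 h3).resolve_right fun h4 => hb1 ?_
        exact Multiplicative.toAdd.injective h4
      subst h2
      rw [zpow_zero, mul_one] at h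
      exact Prod.ext (Subtype.ext h) rfl
    · intro c
      obtain ⟨k, hk⟩ := hgen c
      refine ⟨(⟨c * (b ^ k)⁻¹, ?_⟩, Multiplicative.ofAdd k), ?_⟩
      · rw [MonoidHom.mem_ker, map_mul, map_inv, map_zpow, hk, mul_inv_cancel]
      · rw [hψ, inv_mul_cancel_right]
  have : IsCyclic (Multiplicative (ZMod (Nat.card f.ker))) := inferInstance
  have e : f.ker ≃* Multiplicative (ZMod (Nat.card f.ker)) :=
    mulEquivOfCyclicCardEq (Nat.card_zmod _).symm
  exact ⟨Nat.card f.ker, Nat.card_pos,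
    ⟨((MulEquiv.prodCongr e.symm (MulEquiv.refl _)).trans (MulEquiv.ofBijective ψ hψbij)).symm⟩⟩

/-! ### The eigenvalue character on elements commuting with `A`. -/

namespace Matrix.ProjectiveSpecialLinearGroup

variable {K : Type*} [Field K]

lemma coord_unique {A : SL(2, K)} (hA : (QuotientGroup.mk A : PSL(2, K)) ≠ 1) {x y x' y' : K}
    (h : x • (1 : Matrix (Fin 2) (Fin 2) K) + y • A.1 = x' • 1 + y' • A.1) : x = x' ∧ y = y' := by
  have hy : y = y' := by
    by_contra hne
    have hne' := sub_ne_zero.2 hne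
    refine ne_smul_one_of_mk_ne_one hA ((y - y')⁻¹ * (x' - x)) ?_
    have h1 : (x' - x) • (1 : Matrix (Fin 2) (Fin 2) K) = (y - y') • A.1 := by
      rw [sub_smul, sub_smul, sub_eq_sub_iff_add_eq_add, add_comm, add_comm (y • A.1)]
      rw [h]; exact add_comm _ _
    rw [mul_smul, h1, smul_smul, inv_mul_cancel₀ hne', one_smul]
  subst hy
  have h2 := add_right_cancel h
  have h3 := congrFun (congrFun h2 0) 0
  exact ⟨by simpa using h3, rfl⟩

/-- The eigenvalues of `M` are `x + y l` and its inverse `x + y (t - l)`. If the first squares to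
one, they coincide, and distinctness of the eigenvalues of `A` forces `y = 0`. -/
lemma eq_one_of_eigenvalue_sq_eq_one {L : Type*} [Field L] [Algebra K L] {A M : SL(2, K)}
    {l : L} (hl : l ^ 2 = algebraMap K L (A.1.trace) * l - 1) (ht : A.1.trace ^ 2 ≠ 4) {x y : K}
    (hM : (M : Matrix (Fin 2) (Fin 2) K) = x • 1 + y • A.1)
    (h : (algebraMap K L x + algebraMap K L y * l) ^ 2 = 1) :
    (QuotientGroup.mk M : PSL(2, K)) = 1 := by
  by_contra hne
  have hdet := M.det_coe
  rw [hM, Matrix.det_smul_one_add_smul, A.det_coe, mul_one] at hdet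
  have hdet' := congrArg (algebraMap K L) hdet
  simp only [map_add, map_mul, map_pow, map_one] at hdet'
  set t := algebraMap K L A.1.trace
  set X := algebraMap K L x
  set Y := algebraMap K L y
  have ht' : t ^ 2 - 4 ≠ 0 := by
    have h4 : algebraMap K L (A.1.trace ^ 2 - 4) ≠ 0 :=
      (map_ne_zero _).2 (sub_ne_zero.2 ht)
    simpa only [map_sub, map_pow, map_ofNat] using h4
  have hY : Y ^ 2 * (t ^ 2 - 4) = 0 := by
    have h1 : (X + Y * l) * (X + Y * (t - l)) = 1 := by
      linear_combination hdet' - Y ^ 2 * hl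
    have h2 : (X + Y * l) * (Y * (t - 2 * l)) = 0 := by linear_combination h1 - h
    have h3 : X + Y * l ≠ 0 := by
      intro h3; rw [h3] at h1; simp at h1
    have h4 := (mul_eq_zero.1 h2).resolve_left h3
    linear_combination (Y * (t - 2 * l)) * h4 - 4 * Y ^ 2 * hl
  have hy : y = 0 := by
    have h1 := pow_eq_zero_iff (two_ne_zero) |>.1 ((mul_eq_zero.1 hY).resolve_right ht')
    exact (map_eq_zero _).1 h1
  exact ne_smul_one_of_mk_ne_one hne x (by rw [hM, hy, zero_smul, add_zero])

variable [CharZero K]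

lemma exists_lift_eq_smul_one_add_smul {A : SL(2, K)} {b : PSL(2, K)}
    (ha : (QuotientGroup.mk A : PSL(2, K)) ^ 2 ≠ 1)
    (hb : Commute (QuotientGroup.mk A : PSL(2, K)) b) :
    ∃ (M : SL(2, K)) (x y : K), QuotientGroup.mk M = b ∧
      (M : Matrix (Fin 2) (Fin 2) K) = x • 1 + y • A.1 := by
  induction b using QuotientGroup.induction_on with | H M =>
  have hA : (QuotientGroup.mk A : PSL(2, K)) ≠ 1 := fun h => ha (by rw [h, one_pow])
  obtain ⟨x, y, h⟩ := Matrix.exists_eq_smul_one_add_smul_of_commute (ne_smul_one_of_mk_ne_one hA)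
    (B := M) (by simpa using congrArg Subtype.val (mul_comm_of_commute_mk ha hb))
  exact ⟨M, x, y, rfl, h⟩

/-- The square of the eigenvalue, as a character of a subgroup that commutes with `A`. -/
lemma exists_eigenvalue_sq_hom {L : Type*} [Field L] [Algebra K L] {A : SL(2, K)}
    (ha : (QuotientGroup.mk A : PSL(2, K)) ^ 2 ≠ 1) {l : L}
    (hl : l ^ 2 = algebraMap K L (A.1.trace) * l - 1) (B : Subgroup PSL(2, K))
    (hB : ∀ b ∈ B, Commute (QuotientGroup.mk A : PSL(2, K)) b) :
    ∃ χ : B →* L, ∀ (b : B) (M : SL(2, K)) (x y : K), QuotientGroup.mk M = (b : PSL(2, K)) →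
      (M : Matrix (Fin 2) (Fin 2) K) = x • 1 + y • A.1 →
      χ b = (algebraMap K L x + algebraMap K L y * l) ^ 2 := by
  have hA : (QuotientGroup.mk A : PSL(2, K)) ≠ 1 := fun h => ha (by rw [h, one_pow])
  choose M x y hM hxy using fun b : B => exists_lift_eq_smul_one_add_smul ha (hB b b.2)
  -- The lift of `b` is determined up to sign; squaring the eigenvalue removes the ambiguity.
  have key : ∀ (b : B) (M' : SL(2, K)) (x' y' : K), QuotientGroup.mk M' = (b : PSL(2, K)) →
      (M' : Matrix (Fin 2) (Fin 2) K) = x' • 1 + y' • A.1 →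
      (algebraMap K L (x b) + algebraMap K L (y b) * l) ^ 2 =
        (algebraMap K L x' + algebraMap K L y' * l) ^ 2 := by
    intro b M' x' y' hM' hxy'
    rcases (mk_eq_mk_iff _ _).1 (hM'.trans (hM b).symm) with h | h
    · rw [h, hxy] at hxy'
      obtain ⟨h1, h2⟩ := coord_unique hA hxy'
      rw [h1, h2]
    · rw [h, Matrix.SpecialLinearGroup.coe_neg, hxy, neg_add, ← neg_smul, ← neg_smul] at hxy'
      obtain ⟨h1, h2⟩ := coord_unique hA hxy'
      rw [← h1, ← h2, map_neg, map_neg]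
      ring
  refine ⟨⟨⟨fun b => (algebraMap K L (x b) + algebraMap K L (y b) * l) ^ 2, ?_⟩, ?_⟩, key⟩
  · rw [key 1 1 1 0 rfl (by simp)]
    simp
  · intro b c
    dsimp only
    -- Coordinates of the product of the two lifts, reduced by `A ^ 2 = t A - 1`.
    rw [key (b * c) (M b * M c) (x b * x c - y b * y c)
      (x b * y c + y b * x c + A.1.trace * (y b * y c))]
    · simp only [map_mul, map_add, map_sub, ← mul_pow]
      congr 1
      linear_combination (-(algebraMap K L (y b)) * algebraMap K L (y c)) * hl
    · rw [QuotientGroup.mk_mul, hM, hM]; rfl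
    · rw [Matrix.SpecialLinearGroup.coe_mul, hxy, hxy]
      have := mul_self_eq A
      simp only [add_mul, mul_add, smul_mul_assoc, mul_smul_comm, one_mul, mul_one, this]
      module

lemma exists_eigenvalue_sq_hom_injective {L : Type*} [Field L] [Algebra K L] {A : SL(2, K)}
    (ha : (QuotientGroup.mk A : PSL(2, K)) ^ 2 ≠ 1) (ht : A.1.trace ^ 2 ≠ 4) {l : L}
    (hl : l ^ 2 = algebraMap K L (A.1.trace) * l - 1) (B : Subgroup PSL(2, K))
    (hB : ∀ b ∈ B, Commute (QuotientGroup.mk A : PSL(2, K)) b) :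
    ∃ χ : B →* L, Function.Injective χ := by
  obtain ⟨χ, hχ⟩ := exists_eigenvalue_sq_hom ha hl B hB
  refine ⟨χ, (injective_iff_map_eq_one χ).2 fun b hb => ?_⟩
  obtain ⟨M, x, y, hM, hxy⟩ := exists_lift_eq_smul_one_add_smul ha (hB b b.2)
  rw [hχ b M x y hM hxy] at hb
  exact Subtype.ext (hM.symm.trans (eq_one_of_eigenvalue_sq_eq_one hl ht hxy hb))

lemma isCyclic_of_finite_of_commute {A : SL(2, K)}
    (ha : (QuotientGroup.mk A : PSL(2, K)) ^ 2 ≠ 1) (ht : A.1.trace ^ 2 ≠ 4)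
    (B : Subgroup PSL(2, K)) (hB : ∀ b ∈ B, Commute (QuotientGroup.mk A : PSL(2, K)) b)
    [Finite B] : IsCyclic B := by
  obtain ⟨l, hl⟩ := IsAlgClosed.exists_root (k := AlgebraicClosure K)
    (Polynomial.X ^ 2 - Polynomial.C (algebraMap K (AlgebraicClosure K) A.1.trace) *
      Polynomial.X + 1) (by
      have : (Polynomial.X ^ 2 - Polynomial.C (algebraMap K (AlgebraicClosure K) A.1.trace) *
        Polynomial.X + 1).degree = 2 := by compute_degree!
      rw [this]; exact two_ne_zero)
  obtain ⟨χ, hχ⟩ := exists_eigenvalue_sq_hom_injective (L := AlgebraicClosure K) (l := l) ha ht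
    (by simp only [Polynomial.IsRoot, Polynomial.eval_add, Polynomial.eval_sub,
          Polynomial.eval_pow, Polynomial.eval_X, Polynomial.eval_mul, Polynomial.eval_C,
          Polynomial.eval_one] at hl
        linear_combination hl) B hB
  exact isCyclic_of_injective_ringHom χ hχ

end Matrix.ProjectiveSpecialLinearGroup

/-! ### Discrete subgroups of `PSL₂` over a local field -/

section LocalField

open ValuativeRel

variable {K : Type*} [Field K] [ValuativeRel K] [TopologicalSpace K] [IsNonarchimedeanLocalField K]

instance IsNonarchimedeanLocalField.t1Space : T1Space K := by
  refine IsTopologicalAddGroup.t1Space K ?_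
  rw [← isOpen_compl_iff, isOpen_iff_mem_nhds]
  intro x hx
  have hx' : valuation K x ≠ 0 := (Valuation.ne_zero_iff _).2 hx
  filter_upwards [(valuation K).locally_const hx'] with y hy hy0
  rw [Set.mem_singleton_iff] at hy0
  rw [hy0, map_zero] at hy
  exact hx' hy.symm

lemma IsCompact.exists_valuation_le {C : Set K} (hC : IsCompact C) :
    ∃ γ, ∀ x ∈ C, valuation K x ≤ γ := by
  refine hC.induction_on (p := fun s => ∃ γ, ∀ x ∈ s, valuation K x ≤ γ) ⟨0, by simp⟩
    (fun s t hst ⟨γ, h⟩ => ⟨γ, fun x hx => h x (hst hx)⟩)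
    (fun s t ⟨γ, h⟩ ⟨δ, h'⟩ => ⟨max γ δ, ?_⟩) ?_
  · rintro x (hx | hx)
    · exact (h x hx).trans (le_max_left _ _)
    · exact (h' x hx).trans (le_max_right _ _)
  · intro x _
    refine ⟨{z | valuation K (z - x) < (1 : (ValueGroupWithZero K)ˣ)}, mem_nhdsWithin_of_mem_nhds
      ((IsValuativeTopology.hasBasis_nhds x).mem_of_mem trivial), max 1 (valuation K x), ?_⟩
    intro z hz
    have h1 : valuation K (z - x) ≤ 1 := le_of_lt (by simpa using hz)
    have h2 := (valuation K).map_add (z - x) x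
    rw [sub_add_cancel] at h2
    exact h2.trans (max_le_max h1 le_rfl)

namespace Matrix.ProjectiveSpecialLinearGroup

/-- The center is finite, hence closed. The Hausdorff property is needed so that discrete subgroups
are closed. -/
instance t2Space : T2Space PSL(2, K) := by
  have hfin : ((Subgroup.center SL(2, K) : Subgroup SL(2, K)) : Set SL(2, K)).Finite := by
    refine Set.Finite.subset (Set.toFinite {1, -1}) fun A hA => ?_
    exact (mk_eq_one_iff A).1 ((QuotientGroup.eq_one_iff A).2 hA)
  have : IsClosed ((Subgroup.center SL(2, K) : Subgroup SL(2, K)) : Set SL(2, K)) :=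
    hfin.isClosed
  exact QuotientGroup.instT2Space

/-- Matrices in `SL₂(K)` with bounded entries form a compact set, and its image meets the closed
discrete `B` in a compact discrete set. -/
lemma finite_setOf_exists_lift_valuation_le (B : Subgroup PSL(2, K)) [DiscreteTopology B]
    (γ : ValueGroupWithZero K) :
    {b : PSL(2, K) | b ∈ B ∧ ∃ M : SL(2, K), QuotientGroup.mk M = b ∧
      ∀ i j, valuation K (M i j) ≤ γ}.Finite := by
  have h1 : IsCompact {M : Matrix (Fin 2) (Fin 2) K | ∀ i j, valuation K (M i j) ≤ γ} := by
    have h0 : IsCompact {M : Fin 2 → Fin 2 → K | ∀ i j, valuation K (M i j) ≤ γ} := by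
      have h : {M : Fin 2 → Fin 2 → K | ∀ i j, valuation K (M i j) ≤ γ} =
          Set.univ.pi fun _ => Set.univ.pi fun _ => {x | valuation K x ≤ γ} := by
        ext M; simp [Set.mem_pi]
      rw [h]
      exact isCompact_univ_pi fun _ => isCompact_univ_pi fun _ =>
        IsNonarchimedeanLocalField.isCompact_closedBall K γ
    exact h0
  have h2 : IsCompact {M : SL(2, K) | ∀ i j, valuation K (M i j) ≤ γ} :=
    Matrix.SpecialLinearGroup.isClosedEmbedding_val.isCompact_preimage h1
  have h3 := h2.image (f := (QuotientGroup.mk : SL(2, K) → PSL(2, K))) continuous_quot_mk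
  have h4 : IsClosed (B : Set PSL(2, K)) := Subgroup.isClosed_of_discrete
  have h5 := (h3.inter_left h4).finite (IsDiscrete.mono ⟨‹DiscreteTopology B›⟩
    Set.inter_subset_left)
  refine h5.subset ?_
  rintro b ⟨hb, M, hM, hle⟩
  exact ⟨hb, M, hle, hM⟩

lemma finite_of_coord_valuation_le {A : SL(2, K)}
    (B : Subgroup PSL(2, K)) [DiscreteTopology B] (S : Set B) (γ : ValueGroupWithZero K)
    (hS : ∀ b ∈ S, ∃ (M : SL(2, K)) (x y : K), QuotientGroup.mk M = (b : PSL(2, K)) ∧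
      (M : Matrix (Fin 2) (Fin 2) K) = x • 1 + y • A.1 ∧ valuation K x ≤ γ ∧ valuation K y ≤ γ) :
    S.Finite := by
  obtain ⟨δ, hδ⟩ : ∃ δ, ∀ i j, valuation K (A.1 i j) ≤ δ := by
    have := (Set.finite_range fun p : Fin 2 × Fin 2 => A.1 p.1 p.2).isCompact.exists_valuation_le
    obtain ⟨δ, h⟩ := this
    exact ⟨δ, fun i j => h _ ⟨(i, j), rfl⟩⟩
  refine Set.Finite.of_finite_image (f := Subtype.val) ?_ Subtype.val_injective.injOn
  refine (finite_setOf_exists_lift_valuation_le B (max γ (γ * δ))).subset ?_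
  rintro _ ⟨b, hb, rfl⟩
  obtain ⟨M, x, y, hM, hxy, hx, hy⟩ := hS b hb
  refine ⟨b.2, M, hM, fun i j => ?_⟩
  have h1 : (M : Matrix (Fin 2) (Fin 2) K) i j = x * (1 : Matrix (Fin 2) (Fin 2) K) i j +
    y * A.1 i j := by rw [hxy]; rfl
  refine (le_of_eq (congrArg _ h1)).trans (((valuation K).map_add _ _).trans (max_le_max ?_ ?_))
  · rw [map_mul]
    refine (mul_le_mul' hx 
      (?_ : valuation K ((1 : Matrix (Fin 2) (Fin 2) K) i j) ≤ 1)).trans (mul_one γ).le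
    rw [Matrix.one_apply]; split_ifs <;> simp
  · rw [map_mul]
    exact mul_le_mul' hy (hδ i j)

/-- A quadratic form without nontrivial zeros is bounded away from zero on the unit sphere. -/
lemma exists_valuation_le_of_forall_ne {t : K} (ht : ∀ l : K, l ^ 2 ≠ t * l - 1) :
    ∃ γ, ∀ x y : K, x ^ 2 + x * y * t + y ^ 2 = 1 → valuation K x ≤ γ ∧ valuation K y ≤ γ := by
  have hp : ∀ s : K, 1 + s * t + s ^ 2 ≠ 0 := fun s h => ht (-s) (by linear_combination h)
  have hO := IsNonarchimedeanLocalField.isCompact_closedBall K 1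
  have hcont : Continuous fun s : K => (1 + s * t + s ^ 2)⁻¹ :=
    Continuous.inv₀ (by fun_prop) hp
  obtain ⟨γ, hγ⟩ := (hO.image hcont).exists_valuation_le
  -- By homogeneity `x ^ 2` is the inverse of the form at `(1, y / x)`, which is bounded because `y
  -- / x` lies in the compact unit ball.
  have key : ∀ x y : K, x ^ 2 + x * y * t + y ^ 2 = 1 → valuation K y ≤ valuation K x →
      valuation K x ≤ max 1 γ := by
    intro x y h hyx
    have hx : x ≠ 0 := by
      rintro rfl
      have hy : y = 0 := by simpa using hyx
      rw [hy] at h; simp at h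
    have hx' : valuation K x ≠ 0 := (Valuation.ne_zero_iff _).2 hx
    have hs : valuation K (y / x) ≤ 1 := by
      rw [map_div₀]
      exact div_le_one_of_le₀ hyx zero_le
    have h1 := hγ _ ⟨y / x, hs, rfl⟩
    have h2 : (1 + y / x * t + (y / x) ^ 2)⁻¹ = x ^ 2 := by
      refine inv_eq_of_mul_eq_one_left ?_
      field_simp
      linear_combination h
    simp only at h1
    rw [h2, map_pow] at h1
    rcases le_total (valuation K x) 1 with h3 | h3
    · exact h3.trans (le_max_left _ _)
    · refine le_trans ?_ (h1.trans (le_max_right _ _))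
      rw [pow_two]
      exact le_mul_of_one_le_left' h3
  refine ⟨max 1 γ, fun x y h => ?_⟩
  rcases le_total (valuation K y) (valuation K x) with h1 | h1
  · have := key x y h h1
    exact ⟨this, h1.trans this⟩
  · have := key y x (by linear_combination h) h1
    exact ⟨h1.trans this, this⟩

variable [CharZero K]

/-- A discrete subgroup of `PSL₂` that commutes with a torsion element of order at least three is
cyclic or a product of a finite and an infinite cyclic group. -/
theorem isCyclic_or_prod_of_commute_torsion {a : PSL(2, K)} (ha : a ^ 2 ≠ 1)
    (hfin : IsOfFinOrder a) (B : Subgroup PSL(2, K)) [DiscreteTopology B]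
    (hB : ∀ b ∈ B, Commute a b) :
    IsCyclic B ∨ IsFiniteCyclicProdInfiniteCyclic B := by
  induction a using QuotientGroup.induction_on with | H A =>
  have hA : (QuotientGroup.mk A : PSL(2, K)) ≠ 1 := fun h => ha (by rw [h, one_pow])
  have ht := trace_sq_ne_four hfin hA
  have hdet : ∀ (M : SL(2, K)) (x y : K), (M : Matrix (Fin 2) (Fin 2) K) = x • 1 + y • A.1 →
      x ^ 2 + x * y * A.1.trace + y ^ 2 = 1 := by
    intro M x y hM
    have := M.det_coe
    rwa [hM, Matrix.det_smul_one_add_smul, A.det_coe, mul_one] at this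
  by_cases hsplit : ∃ l : K, l ^ 2 = A.1.trace * l - 1
  · obtain ⟨l, hl⟩ := hsplit
    set t := A.1.trace with htdef
    obtain ⟨χ, hχ⟩ := exists_eigenvalue_sq_hom (L := K) (l := l) ha (by simpa using hl) B hB
    let e := IsNonarchimedeanLocalField.valueGroupWithZeroIsoInt K
    let ν : B →* (ValueGroupWithZero K)ˣ :=
      (((valuation K).toMonoidWithZeroHom.toMonoidHom).comp χ).toHomUnits
    let f : B →* Multiplicative ℤ := WithZero.unitsWithZeroEquiv.toMonoidHom.comp
      ((Units.map e.toMulEquiv.toMonoidHom).comp ν)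
    have hker : ∀ b ∈ f.ker, valuation K (χ b) = 1 := by
      intro b hb
      rw [MonoidHom.mem_ker] at hb
      have h1 : Units.map e.toMulEquiv.toMonoidHom (ν b) = 1 :=
        (MulEquiv.map_eq_one_iff WithZero.unitsWithZeroEquiv).1 hb
      exact (MulEquiv.map_eq_one_iff e.toMulEquiv).1 (congrArg Units.val h1)
    have hdl : l - (t - l) ≠ 0 := by
      intro h
      have h1 : (l - (t - l)) * (l - (t - l)) = t ^ 2 - 4 := by linear_combination 4 * hl
      rw [h, zero_mul] at h1
      exact sub_ne_zero.2 ht h1.symm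
    -- On the kernel both eigenvalues `x + y l` and `x + y (t - l)` have valuation one. Their
    -- difference bounds `y`, and then `x`.
    have hkerfin : Finite f.ker := by
      set γ := (valuation K (l - (t - l)))⁻¹ with hγ
      refine (finite_of_coord_valuation_le (A := A) B (f.ker : Set B)
        (max γ (max 1 (γ * valuation K l))) ?_).to_subtype
      intro b hb
      obtain ⟨M, x, y, hM, hxy⟩ := exists_lift_eq_smul_one_add_smul ha (hB b b.2)
      refine ⟨M, x, y, hM, hxy, ?_⟩
      have h1 := hker b hb
      rw [hχ b M x y hM hxy, map_pow] at h1
      simp only [Algebra.algebraMap_self, RingHom.id_apply] at h1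
      have h2 : valuation K (x + y * l) = 1 := (pow_eq_one_iff_of_nonneg zero_le two_ne_zero).1 h1
      have h3 : (x + y * l) * (x + y * (t - l)) = 1 := by
        linear_combination hdet M x y hxy - y ^ 2 * hl
      have h4 : valuation K (x + y * (t - l)) = 1 := by
        have := congrArg (valuation K) h3
        rwa [map_mul, h2, one_mul, map_one] at this
      have hy : valuation K y ≤ γ := by
        have h5 : valuation K (y * (l - (t - l))) ≤ 1 := by
          have h6 : y * (l - (t - l)) = (x + y * l) - (x + y * (t - l)) := by ring
          rw [h6]
          refine ((valuation K).map_sub _ _).trans ?_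
          rw [h2, h4, max_self]
        rw [map_mul] at h5
        rw [hγ]
        exact (le_mul_inv_iff₀ (zero_lt_iff.2 ((Valuation.ne_zero_iff _).2 hdl))).2 h5 |>.trans
          (one_mul _).le
      refine ⟨le_max_of_le_right ?_, le_max_of_le_left hy⟩
      have h7 : x = (x + y * l) - y * l := by ring
      rw [h7]
      refine ((valuation K).map_sub _ _).trans (max_le_max h2.le ?_)
      rw [map_mul]
      exact mul_le_mul' hy le_rfl
    have hkercyc : IsCyclic f.ker := by
      let e := f.ker.equivMapOfInjective B.subtype B.subtype_injective
      have hfin' : Finite (f.ker.map B.subtype) := Finite.of_equiv _ e.toEquiv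
      have := isCyclic_of_finite_of_commute ha ht (f.ker.map B.subtype) (by
        rintro _ ⟨b, -, rfl⟩
        exact hB b b.2)
      exact e.isCyclic.2 this
    exact isCyclic_or_isFiniteCyclicProdInfiniteCyclic
      (fun x y => Subtype.ext (commute_of_commute ha (hB x x.2) (hB y y.2))) f hkerfin hkercyc
  · left
    push Not at hsplit
    -- Nonsplit torus: the determinant is an anisotropic form in the coordinates, so determinant one
    -- bounds them.
    obtain ⟨γ, hγ⟩ := exists_valuation_le_of_forall_ne hsplit
    have : Finite B := by
      refine Set.finite_univ_iff.1 (finite_of_coord_valuation_le (A := A) B Set.univ γ ?_)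
      intro b _
      obtain ⟨M, x, y, hM, hxy⟩ := exists_lift_eq_smul_one_add_smul ha (hB b b.2)
      exact ⟨M, x, y, hM, hxy, hγ x y (hdet M x y hxy)⟩
    exact isCyclic_of_finite_of_commute ha ht B hB

end Matrix.ProjectiveSpecialLinearGroup

end LocalField

/-! ### Stabilizers of components of fixed edges -/

/-- In a group with transitive commutation that acts with finite commutative stabilizers, the
stabilizer of a component of the graph of fixed edges is trivial or commutes with a torsion
element. -/
theorem eq_bot_or_exists_torsion_commute {G V : Type*} [Group G] [MulAction G V]
    {T : SimpleGraph V} (htwo : ∀ g : G, g ^ 2 = 1 → g = 1)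
    (htrans : ∀ a b c : G, a ≠ 1 → Commute a b → Commute a c → Commute b c)
    (hcomm : ∀ (x : V) (a b : G), a • x = x → b • x = x → Commute a b)
    (hfin : ∀ (x : V) (a : G), a • x = x → IsOfFinOrder a)
    (hconj : ∀ a g : G, a ≠ 1 → IsOfFinOrder a → Commute a (g * a * g⁻¹) →
      g * a * g⁻¹ = a ∨ g * a * g⁻¹ = a⁻¹)
    (hinv : ∀ (g : G) (x y : V), T.Adj x y → T.Adj (g • x) (g • y))
    (B : Subgroup G) (x : V) (hB : ∀ g ∈ B, (fixedEdgeGraph G T).Reachable x (g • x)) :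
    B = ⊥ ∨ ∃ a : G, a ≠ 1 ∧ IsOfFinOrder a ∧ ∀ g ∈ B, Commute a g := by
  by_cases h : ∃ y, (fixedEdgeGraph G T).Reachable x y ∧ ∃ a : G, a ≠ 1 ∧ a • y = y
  · right
    obtain ⟨y, hxy, a, ha, hay⟩ := h
    -- The nontrivial element `c` fixing an edge commutes with the vertex groups at both ends, so
    -- transitivity carries commutation with `a` across the edge.
    have hcommz : ∀ z, (fixedEdgeGraph G T).Reachable y z → ∀ b : G, b • z = z → Commute a b := by
      intro z hz
      refine hz.induction_on (P := fun z => ∀ b : G, b • z = z → Commute a b)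
        (fun b hb => hcomm y a b hay hb) ?_
      rintro z w ⟨-, c, hc, hcz, hcw⟩ ih b hb
      exact htrans c a b hc (ih c hcz).symm (hcomm w c b hcw hb)
    refine ⟨a, ha, hfin y a hay, fun g hg => ?_⟩
    have hgy : (fixedEdgeGraph G T).Reachable (g • x) (g • y) :=
      hxy.map ⟨fun x => g • x, fixedEdgeGraph_smul hinv g⟩
    have h1 : Commute a (g * a * g⁻¹) :=
      hcommz (g • y) ((hxy.symm.trans (hB g hg)).trans hgy) _
        (by rw [mul_smul, mul_smul, inv_smul_smul, hay])
    rcases hconj a g ha (hfin y a hay) h1 with h2 | h2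
    · exact (mul_inv_eq_iff_eq_mul.1 h2).symm
    · by_cases hg2 : g ^ 2 = 1
      · rw [htwo g hg2]; exact Commute.one_right a
      · have h3 : g * a = a⁻¹ * g := mul_inv_eq_iff_eq_mul.1 h2
        have h4 : Commute (g ^ 2) a := by
          have h5 : SemiconjBy g a a⁻¹ := h3
          have h6 : SemiconjBy g a⁻¹ a := by simpa using h5.inv_right
          rw [pow_two]
          exact h6.mul_left h5
        exact htrans (g ^ 2) a g hg2 h4 ((Commute.refl g).pow_left 2)
  -- The component is then the single vertex `x`, since a fixed edge at `x` would give a nontrivial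
  -- element fixing `x`; so `B` fixes `x`.
  · left
    push Not at h
    rw [Subgroup.eq_bot_iff_forall]
    intro g hg
    have hx : ∀ z, (fixedEdgeGraph G T).Reachable x z → z = x := by
      intro z hz
      refine hz.induction_on (P := fun z => z = x) rfl ?_
      rintro z w ⟨-, c, hc, hcz, -⟩ rfl
      exact absurd hcz (h z (SimpleGraph.Reachable.refl _) c hc)
    by_contra hne
    exact h x (SimpleGraph.Reachable.refl _) g hne (hx _ (hB g hg))

/-! ### The tree of `GL₂` over a discretely valued field -/

/-- A graph in which every vertex is joined to its parent, where parents lower the level by one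
and any two vertices have a common ancestor, is a tree. -/
lemma SimpleGraph.isTree_of_parent {V : Type*} [Nonempty V] {T : SimpleGraph V} (p : V → V)
    (level : V → ℤ) (hlevel : ∀ x, level (p x) = level x - 1)
    (hadj : ∀ x y, T.Adj x y ↔ y = p x ∨ x = p y)
    (hconn : ∀ x y, ∃ m n : ℕ, p^[m] x = p^[n] y) : T.IsTree := by
  have hreach : ∀ (m : ℕ) x, T.Reachable x (p^[m] x) := by
    intro m
    induction m with
    | zero => exact fun x => Reachable.refl _
    | succ m ih =>
      intro x
      rw [Function.iterate_succ_apply]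
      exact (Adj.reachable ((hadj _ _).2 (Or.inl rfl))).trans (ih _)
  have hlev : ∀ (m : ℕ) x, level (p^[m] x) = level x - m := by
    intro m
    induction m with
    | zero => simp
    | succ m ih =>
      intro x
      rw [Function.iterate_succ_apply, ih, hlevel]
      push_cast
      ring
  -- Without this edge the descendants of `x` cannot be left, and the level shows that `p x` is not
  -- one of them.
  have hbr : ∀ x, ¬ (T.deleteEdges {s(x, p x)}).Reachable x (p x) := by
    intro x h
    have h1 : ∃ k : ℕ, p^[k] (p x) = x := by
      refine h.induction_on (P := fun z => ∃ k : ℕ, p^[k] z = x) ⟨0, rfl⟩ ?_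
      rintro z w hzw ⟨k, hk⟩
      rw [deleteEdges_adj, hadj] at hzw
      rcases hzw with ⟨rfl | rfl, hne⟩
      · cases k with
        | zero =>
          obtain rfl : z = x := hk
          exact absurd rfl hne
        | succ k => exact ⟨k, hk⟩
      · exact ⟨k + 1, hk⟩
    obtain ⟨k, hk⟩ := h1
    have h2 := hlev k (p x)
    rw [hk, hlevel] at h2
    omega
  refine ⟨⟨fun x y => ?_⟩, ?_⟩
  · obtain ⟨m, n, h⟩ := hconn x y
    exact (hreach m x).trans (h ▸ (hreach n y).symm)
  · rw [isAcyclic_iff_forall_adj_isBridge]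
    intro x y hxy
    rw [isBridge_iff]
    rcases (hadj x y).1 hxy with rfl | rfl
    · exact hbr x
    · intro h
      rw [Sym2.eq_swap] at h
      exact hbr y h.symm

section BruhatTits

open Matrix

variable {K Γ₀ : Type*} [Field K] [LinearOrderedCommGroupWithZero Γ₀] (v : Valuation K Γ₀)

/-- The invertible matrices `g` such that, after scaling, `g` is integral with determinant of the
same valuation as `d`. -/
def scaledIntegral (d : K) : Set (GL (Fin 2) K) :=
  {g | ∃ c : K, c ≠ 0 ∧ (∀ i j, v (g i j) ≤ v c) ∧ v (g : Matrix (Fin 2) (Fin 2) K).det =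
    v d * v c ^ 2}

variable {v}

lemma valuation_mul_apply_le {A B : Matrix (Fin 2) (Fin 2) K} {γ δ : Γ₀}
    (hA : ∀ i j, v (A i j) ≤ γ) (hB : ∀ i j, v (B i j) ≤ δ) (i j : Fin 2) :
    v ((A * B) i j) ≤ γ * δ := by
  rw [Matrix.mul_apply, Fin.sum_univ_two]
  refine (v.map_add _ _).trans (max_le ?_ ?_) <;>
  · rw [map_mul]
    exact mul_le_mul' (hA _ _) (hB _ _)

lemma scaledIntegral_mul {d e : K} {g h : GL (Fin 2) K} (hg : g ∈ scaledIntegral v d)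
    (hh : h ∈ scaledIntegral v e) : g * h ∈ scaledIntegral v (d * e) := by
  obtain ⟨c, hc, h1, h2⟩ := hg
  obtain ⟨c', hc', h1', h2'⟩ := hh
  refine ⟨c * c', mul_ne_zero hc hc', fun i j => ?_, ?_⟩
  · rw [map_mul]
    exact valuation_mul_apply_le h1 h1' i j
  · rw [Units.val_mul, Matrix.det_mul, map_mul, h2, h2', map_mul, map_mul, mul_pow]
    exact mul_mul_mul_comm _ _ _ _

lemma scaledIntegral_inv {d : K} (hd : d ≠ 0) {g : GL (Fin 2) K} (hg : g ∈ scaledIntegral v d) :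
    g⁻¹ ∈ scaledIntegral v d := by
  obtain ⟨c, hc, h1, h2⟩ := hg
  have hc' : v c ≠ 0 := v.ne_zero_iff.2 hc
  have hd' : v d ≠ 0 := v.ne_zero_iff.2 hd
  refine ⟨(c * d)⁻¹, inv_ne_zero (mul_ne_zero hc hd), fun i j => ?_, ?_⟩
  · have h3 : v ((g : Matrix (Fin 2) (Fin 2) K).adjugate i j) ≤ v c := by
      rw [Matrix.adjugate_fin_two]
      fin_cases i <;> fin_cases j <;> simpa using h1 _ _
    rw [Matrix.coe_units_inv, Matrix.inv_def, Ring.inverse_eq_inv', Matrix.smul_apply, smul_eq_mul,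
      map_mul, map_inv₀, h2, map_inv₀, map_mul]
    calc (v d * v c ^ 2)⁻¹ * v ((g : Matrix (Fin 2) (Fin 2) K).adjugate i j)
        ≤ (v d * v c ^ 2)⁻¹ * v c := mul_le_mul' le_rfl h3
      _ = (v c * v d)⁻¹ := by field_simp
  · rw [Matrix.coe_units_inv, Matrix.det_nonsing_inv, Ring.inverse_eq_inv', map_inv₀, h2, map_inv₀,
      map_mul]
    field_simp

variable (v)

/-- The stabilizer of the standard vertex. -/
def vertexSubgroup : Subgroup (GL (Fin 2) K) where
  carrier := scaledIntegral v 1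
  mul_mem' hg hh := by simpa using scaledIntegral_mul hg hh
  one_mem' := ⟨1, one_ne_zero, fun i j => by
    rw [Units.val_one, Matrix.one_apply]; split_ifs <;> simp, by simp⟩
  inv_mem' hg := scaledIntegral_inv one_ne_zero hg

/-- The powers of `ϖ` have all possible nonzero valuations. -/
structure GeneratesValues (ϖ : K) : Prop where
  ne_zero : ϖ ≠ 0
  lt_one : v ϖ < 1
  exists_zpow : ∀ x : K, x ≠ 0 → ∃ k : ℤ, v x = v ϖ ^ k

variable {v} {ϖ : K}

namespace GeneratesValues

variable (hϖ : GeneratesValues v ϖ)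
include hϖ

lemma pos : 0 < v ϖ := zero_lt_iff.2 (v.ne_zero_iff.2 hϖ.ne_zero)

lemma zpow_inj {k l : ℤ} (h : v ϖ ^ k = v ϖ ^ l) : k = l :=
  zpow_right_injective₀ hϖ.pos hϖ.lt_one.ne h

lemma zpow_le_zpow_iff {k l : ℤ} : v ϖ ^ k ≤ v ϖ ^ l ↔ l ≤ k :=
  zpow_le_zpow_iff_right_of_lt_one₀ hϖ.pos hϖ.lt_one

/-- The Bruhat–Tits graph on homothety classes of lattices. -/
def bruhatTitsGraph : SimpleGraph (GL (Fin 2) K ⧸ vertexSubgroup v) where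
  Adj x y := ∃ g h : GL (Fin 2) K, QuotientGroup.mk g = x ∧ QuotientGroup.mk h = y ∧
    g⁻¹ * h ∈ scaledIntegral v ϖ
  symm := ⟨fun _ _ ⟨g, h, hg, hh, hgh⟩ => ⟨h, g, hh, hg, by
    simpa using scaledIntegral_inv hϖ.ne_zero hgh⟩⟩
  loopless := ⟨by
    -- Parity of the determinant's valuation: a loop would give `1 + 2 k = 2 l`.
    rintro _ ⟨g, h, rfl, hh, c, hc, -, h2⟩
    obtain ⟨c', hc', -, h2'⟩ : g⁻¹ * h ∈ scaledIntegral v 1 :=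
      QuotientGroup.eq.1 hh.symm
    obtain ⟨k, hk⟩ := hϖ.exists_zpow c hc
    obtain ⟨l, hl⟩ := hϖ.exists_zpow c' hc'
    rw [h2, map_one, one_mul, hk, hl, ← zpow_natCast, ← zpow_natCast, ← _root_.zpow_mul,
      ← _root_.zpow_mul,      ← zpow_one_add₀ hϖ.pos.ne'] at h2'
    have := hϖ.zpow_inj h2'
    omega⟩

lemma adj_mk_mk_iff (g h : GL (Fin 2) K) :
    hϖ.bruhatTitsGraph.Adj (QuotientGroup.mk g) (QuotientGroup.mk h) ↔
      g⁻¹ * h ∈ scaledIntegral v ϖ := by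
  refine ⟨?_, fun H => ⟨g, h, rfl, rfl, H⟩⟩
  rintro ⟨g', h', hg, hh, H⟩
  have h1 : g⁻¹ * g' ∈ scaledIntegral v 1 := QuotientGroup.eq.1 hg.symm
  have h2 : h'⁻¹ * h ∈ scaledIntegral v 1 := QuotientGroup.eq.1 hh
  have h3 := scaledIntegral_mul (scaledIntegral_mul h1 H) h2
  rw [one_mul, mul_one] at h3
  have h4 : g⁻¹ * g' * (g'⁻¹ * h') * (h'⁻¹ * h) = g⁻¹ * h := by group
  rwa [h4] at h3

lemma adj_smul (g : GL (Fin 2) K) (x y : GL (Fin 2) K ⧸ vertexSubgroup v)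
    (h : hϖ.bruhatTitsGraph.Adj x y) : hϖ.bruhatTitsGraph.Adj (g • x) (g • y) := by
  obtain ⟨a, b, rfl, rfl, hab⟩ := h
  refine ⟨g * a, g * b, rfl, rfl, ?_⟩
  have : (g * a)⁻¹ * (g * b) = a⁻¹ * b := by group
  rwa [this]

end GeneratesValues

/-! ### Vertices of the tree as discs in `K`. -/

/-- The affine transformation `z ↦ a * z + b`. -/
def affineGL (a : Kˣ) (b : K) : GL (Fin 2) K :=
  GeneralLinearGroup.mkOfDetNeZero !![(a : K), b; 0, 1] (by simp)

lemma affineGL_inv_mul (a a' : Kˣ) (b b' : K) :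
    ((affineGL a b)⁻¹ * affineGL a' b' : GL (Fin 2) K) = affineGL (a⁻¹ * a') ((b' - b) / a) := by
  rw [inv_mul_eq_iff_eq_mul]
  ext i j
  fin_cases i <;> fin_cases j <;>
    simp [affineGL, GeneralLinearGroup.mkOfDetNeZero, Matrix.mul_apply, Fin.sum_univ_two]
  field_simp
  ring

lemma affineGL_mem_iff (a : Kˣ) (b d : K) : affineGL a b ∈ scaledIntegral v d ↔
    ∃ c : K, c ≠ 0 ∧ v a ≤ v c ∧ v b ≤ v c ∧ 1 ≤ v c ∧ v a = v d * v c ^ 2 := by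
  have h1 : ∀ i j, (affineGL a b) i j = (!![(a : K), b; 0, 1] : Matrix (Fin 2) (Fin 2) K) i j :=
    fun i j => rfl
  have h2 : (affineGL a b : Matrix (Fin 2) (Fin 2) K).det = a := by
    change (!![(a : K), b; 0, 1] : Matrix (Fin 2) (Fin 2) K).det = a
    simp
  simp only [scaledIntegral, Set.mem_ofPred_eq, h1, h2, Fin.forall_fin_two]
  refine exists_congr fun c => and_congr_right fun hc => ?_
  simp
  tauto

/-- Vertices are discs: `b` is the center and `v a` the radius, and any point of a disc may serve as
its center. -/
lemma mk_affineGL_eq_iff (a a' : Kˣ) (b b' : K) :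
    (QuotientGroup.mk (affineGL a b) : GL (Fin 2) K ⧸ vertexSubgroup v) =
      QuotientGroup.mk (affineGL a' b') ↔ v a = v a' ∧ v (b' - b) ≤ v a := by
  have ha : v (a : K) ≠ 0 := v.ne_zero_iff.2 a.ne_zero
  rw [QuotientGroup.eq, affineGL_inv_mul]
  change affineGL _ _ ∈ scaledIntegral v 1 ↔ _
  rw [affineGL_mem_iff]
  simp only [Units.val_mul, Units.val_inv_eq_inv_val, map_mul, map_inv₀, map_div₀, map_one, one_mul]
  constructor
  · rintro ⟨c, hc, h1, h2, h3, h4⟩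
    have hc1 : v c = 1 := by
      refine le_antisymm ?_ h3
      rw [h4, pow_two] at h1
      by_contra! hlt
      exact absurd h1 (not_le.2 (lt_mul_of_one_lt_left (zero_lt_iff.2 (v.ne_zero_iff.2 hc)) hlt))
    rw [hc1] at h2 h4
    rw [one_pow] at h4
    exact ⟨(inv_mul_eq_one₀ ha).1 h4, by simpa using (div_le_iff₀ (zero_lt_iff.2 ha)).1 h2⟩
  · rintro ⟨h1, h2⟩
    refine ⟨1, one_ne_zero, ?_⟩
    rw [← h1, inv_mul_cancel₀ ha]
    simpa using div_le_one_of_le₀ h2 zero_le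

/-- Iwasawa decomposition: an element of the vertex subgroup turns the bottom row into `(0, 1)`,
with its entry of larger valuation as pivot. -/
lemma exists_mk_affineGL_eq (x : GL (Fin 2) K ⧸ vertexSubgroup v) :
    ∃ (a : Kˣ) (b : K), QuotientGroup.mk (affineGL a b) = x := by
  induction x using QuotientGroup.induction_on with | H g =>
  have hdet : (g : Matrix (Fin 2) (Fin 2) K).det ≠ 0 := g.det.ne_zero
  have hdet' := Matrix.det_fin_two (g : Matrix (Fin 2) (Fin 2) K)
  rcases le_total (v (g 1 0)) (v (g 1 1)) with h | h
  · have hs : g 1 1 ≠ 0 := by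
      intro hs
      have hr : g 1 0 = 0 := by simpa [hs] using h
      rw [hdet', hs, hr] at hdet; simp at hdet
    let k : GL (Fin 2) K := GeneralLinearGroup.mkOfDetNeZero
      !![(g 1 1)⁻¹, 0; -(g 1 0) / (g 1 1) ^ 2, (g 1 1)⁻¹] (by simp [hs])
    refine ⟨Units.mk0 ((g : Matrix (Fin 2) (Fin 2) K).det / (g 1 1) ^ 2)
      (div_ne_zero hdet (pow_ne_zero _ hs)), g 0 1 / g 1 1, ?_⟩
    have h1 : affineGL (Units.mk0 ((g : Matrix (Fin 2) (Fin 2) K).det / (g 1 1) ^ 2)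
      (div_ne_zero hdet (pow_ne_zero _ hs))) (g 0 1 / g 1 1) = g * k := by
      ext i j
      fin_cases i <;> fin_cases j <;>
        simp [affineGL, GeneralLinearGroup.mkOfDetNeZero, Matrix.mul_apply, Fin.sum_univ_two, k,
          hdet'] <;> field_simp <;> ring
    rw [h1, eq_comm, QuotientGroup.eq, inv_mul_cancel_left]
    have hs' : v (g 1 1) ≠ 0 := v.ne_zero_iff.2 hs
    refine ⟨(g 1 1)⁻¹, inv_ne_zero hs, ?_, ?_⟩
    · have h2 : v (-(g 1 0) / (g 1 1) ^ 2) ≤ v (g 1 1)⁻¹ := by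
        rw [map_div₀, Valuation.map_neg, map_pow, map_inv₀,
          div_le_iff₀ (pow_pos (zero_lt_iff.2 hs') 2), pow_two, inv_mul_cancel_left₀ hs']
        exact h
      intro i j
      change v (!![(g 1 1)⁻¹, 0; -(g 1 0) / (g 1 1) ^ 2, (g 1 1)⁻¹] i j) ≤ _
      fin_cases i <;> fin_cases j <;> simp
      simpa using h2
    · change v (!![(g 1 1)⁻¹, 0; -(g 1 0) / (g 1 1) ^ 2, (g 1 1)⁻¹]).det = _
      simp [Matrix.det_fin_two, pow_two]
  · have hr : g 1 0 ≠ 0 := by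
      intro hr
      have hs : g 1 1 = 0 := by simpa [hr] using h
      rw [hdet', hs, hr] at hdet; simp at hdet
    let k : GL (Fin 2) K := GeneralLinearGroup.mkOfDetNeZero
      !![-(g 1 1) / (g 1 0) ^ 2, (g 1 0)⁻¹; (g 1 0)⁻¹, 0] (by simp [hr])
    refine ⟨Units.mk0 (-(g : Matrix (Fin 2) (Fin 2) K).det / (g 1 0) ^ 2)
      (div_ne_zero (neg_ne_zero.2 hdet) (pow_ne_zero _ hr)), g 0 0 / g 1 0, ?_⟩
    have h1 : affineGL (Units.mk0 (-(g : Matrix (Fin 2) (Fin 2) K).det / (g 1 0) ^ 2)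
      (div_ne_zero (neg_ne_zero.2 hdet) (pow_ne_zero _ hr))) (g 0 0 / g 1 0) = g * k := by
      ext i j
      fin_cases i <;> fin_cases j <;>
        simp [affineGL, GeneralLinearGroup.mkOfDetNeZero, Matrix.mul_apply, Fin.sum_univ_two, k,
          hdet'] <;> field_simp <;> ring
    rw [h1, eq_comm, QuotientGroup.eq, inv_mul_cancel_left]
    have hr' : v (g 1 0) ≠ 0 := v.ne_zero_iff.2 hr
    refine ⟨(g 1 0)⁻¹, inv_ne_zero hr, ?_, ?_⟩
    · have h2 : v (-(g 1 1) / (g 1 0) ^ 2) ≤ v (g 1 0)⁻¹ := by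
        rw [map_div₀, Valuation.map_neg, map_pow, map_inv₀,
          div_le_iff₀ (pow_pos (zero_lt_iff.2 hr') 2), pow_two, inv_mul_cancel_left₀ hr']
        exact h
      intro i j
      change v (!![-(g 1 1) / (g 1 0) ^ 2, (g 1 0)⁻¹; (g 1 0)⁻¹, 0] i j) ≤ _
      fin_cases i <;> fin_cases j <;> simp
      simpa using h2
    · change v (!![-(g 1 1) / (g 1 0) ^ 2, (g 1 0)⁻¹; (g 1 0)⁻¹, 0]).det = _
      simp [Matrix.det_fin_two, pow_two]

namespace GeneratesValues

variable (hϖ : GeneratesValues v ϖ)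
include hϖ

lemma adj_affineGL_iff (a a' : Kˣ) (b b' : K) :
    hϖ.bruhatTitsGraph.Adj (QuotientGroup.mk (affineGL a b)) (QuotientGroup.mk (affineGL a' b')) ↔
      (v a' = v a * v ϖ ∧ v (b' - b) ≤ v a) ∨ (v a = v a' * v ϖ ∧ v (b' - b) ≤ v a') := by
  have ha : v (a : K) ≠ 0 := v.ne_zero_iff.2 a.ne_zero
  have ha' : 0 < v (a : K) := zero_lt_iff.2 ha
  have hp := hϖ.pos
  rw [adj_mk_mk_iff, affineGL_inv_mul, affineGL_mem_iff]
  simp only [Units.val_mul, Units.val_inv_eq_inv_val, map_mul, map_inv₀, map_div₀]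
  constructor
  · rintro ⟨c, hc, h1, h2, h3, h4⟩
    obtain ⟨k, hk⟩ := hϖ.exists_zpow c hc
    rw [hk] at h1 h2 h3 h4
    have h5 : k ≤ 0 := hϖ.zpow_le_zpow_iff.1 (by simpa using h3)
    have h6 : k ≤ 1 + 2 * k := by
      refine hϖ.zpow_le_zpow_iff.1 (le_of_eq_of_le ?_ h1)
      rw [h4, zpow_one_add₀ hp.ne', mul_comm 2 k, _root_.zpow_mul, zpow_ofNat]
    -- The scaling exponent decides which disc contains the other; the radii differ by one factor `v
    -- ϖ`.
    obtain rfl | rfl : k = 0 ∨ k = -1 := by omega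
    · left
      rw [zpow_zero] at h2 h4
      rw [one_pow, mul_one] at h4
      exact ⟨(inv_mul_eq_iff_eq_mul₀ ha).1 h4, by simpa using (div_le_iff₀ ha').1 h2⟩
    · right
      have h7 : v (a' : K) = v a * (v ϖ)⁻¹ := by
        rw [inv_mul_eq_iff_eq_mul₀ ha] at h4
        rw [h4, _root_.zpow_neg_one]
        field_simp
      rw [_root_.zpow_neg_one, div_le_iff₀ ha', mul_comm] at h2
      exact ⟨by rw [h7, inv_mul_cancel_right₀ hp.ne'], h7 ▸ h2⟩
  · rintro (⟨h1, h2⟩ | ⟨h1, h2⟩)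
    · refine ⟨1, one_ne_zero, ?_, ?_, by simp, ?_⟩
      · rw [h1, inv_mul_cancel_left₀ ha, map_one]; exact hϖ.lt_one.le
      · rw [map_one]; exact div_le_one_of_le₀ h2 zero_le
      · rw [h1, inv_mul_cancel_left₀ ha]; simp
    · have ha0 : v (a' : K) ≠ 0 := v.ne_zero_iff.2 a'.ne_zero
      refine ⟨ϖ⁻¹, inv_ne_zero hϖ.ne_zero, ?_, ?_, ?_, ?_⟩ <;> rw [map_inv₀]
      · rw [h1]; refine le_of_eq ?_; field_simp
      · rw [h1, div_le_iff₀ (mul_pos (zero_lt_iff.2 ha0) hp)]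
        refine h2.trans (le_of_eq ?_); field_simp
      · exact (one_le_inv₀ hp).2 hϖ.lt_one.le
      · rw [h1]; field_simp

/-- The parent of a disc has the same center and the next larger radius. Two discs have a common
ancestor as soon as its radius exceeds both radii and the distance of the centers; `M` below is such
an exponent. -/
theorem bruhatTitsGraph_isTree : hϖ.bruhatTitsGraph.IsTree := by
  choose a b hab using exists_mk_affineGL_eq (v := v)
  choose level hlevel using fun x => hϖ.exists_zpow (a x : K) (a x).ne_zero
  let ϖu : Kˣ := Units.mk0 ϖ hϖ.ne_zero
  let p : GL (Fin 2) K ⧸ vertexSubgroup v → GL (Fin 2) K ⧸ vertexSubgroup v :=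
    fun x => QuotientGroup.mk (affineGL (a x * ϖu⁻¹) (b x))
  have hp : ∀ a' b', p (QuotientGroup.mk (affineGL a' b')) =
      QuotientGroup.mk (affineGL (a' * ϖu⁻¹) b') := by
    intro a' b'
    obtain ⟨h1, h2⟩ := (mk_affineGL_eq_iff _ _ _ _).1 (hab (QuotientGroup.mk (affineGL a' b')))
    refine (mk_affineGL_eq_iff _ _ _ _).2 ⟨?_, ?_⟩
    · simp [h1]
    · refine h2.trans ?_
      rw [Units.val_mul, map_mul]
      refine le_mul_of_one_le_right' ?_
      simpa [ϖu] using (one_le_inv₀ hϖ.pos).2 hϖ.lt_one.le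
  have hpm : ∀ (m : ℕ) a' b', p^[m] (QuotientGroup.mk (affineGL a' b')) =
      QuotientGroup.mk (affineGL (a' * (ϖu⁻¹) ^ m) b') := by
    intro m
    induction m with
    | zero => simp
    | succ m ih =>
      intro a' b'
      rw [Function.iterate_succ_apply, hp, ih, mul_assoc, ← pow_succ']
  have hval : ∀ x a' b', QuotientGroup.mk (affineGL a' b') = x → v (a' : K) = v ϖ ^ level x := by
    rintro x a' b' rfl
    rw [← hlevel]
    exact ((mk_affineGL_eq_iff _ _ _ _).1 (hab (QuotientGroup.mk (affineGL a' b')))).1.symm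
  refine SimpleGraph.isTree_of_parent p level ?_ ?_ ?_
  · intro x
    refine hϖ.zpow_inj ?_
    rw [← hval (p x) _ _ rfl, zpow_sub_one₀ hϖ.pos.ne', ← hlevel]
    simp [ϖu]
  · intro x y
    obtain ⟨a', b', rfl⟩ := exists_mk_affineGL_eq x
    obtain ⟨c', d', rfl⟩ := exists_mk_affineGL_eq y
    rw [adj_affineGL_iff, hp, hp, mk_affineGL_eq_iff, mk_affineGL_eq_iff, or_comm]
    have hpos := hϖ.pos.ne'
    refine or_congr ?_ ?_
    · simp only [Units.val_mul, Units.val_inv_eq_inv_val, map_mul, map_inv₀, ϖu, Units.val_mk0]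
      rw [v.map_sub_swap b' d', eq_mul_inv_iff_mul_eq₀ hpos, eq_comm]
    · simp only [Units.val_mul, Units.val_inv_eq_inv_val, map_mul, map_inv₀, ϖu, Units.val_mk0]
      rw [eq_mul_inv_iff_mul_eq₀ hpos, eq_comm]
  · intro x y
    obtain ⟨a', b', rfl⟩ := exists_mk_affineGL_eq x
    obtain ⟨c', d', rfl⟩ := exists_mk_affineGL_eq y
    obtain ⟨k, hk⟩ := hϖ.exists_zpow a' a'.ne_zero
    obtain ⟨l, hl⟩ := hϖ.exists_zpow c' c'.ne_zero
    obtain ⟨r, hr⟩ : ∃ r : ℤ, v (d' - b') ≤ v ϖ ^ r := by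
      by_cases h : d' - b' = 0
      · exact ⟨0, by simp [h]⟩
      · obtain ⟨r, hr⟩ := hϖ.exists_zpow _ h
        exact ⟨r, hr.le⟩
    set M := min k (min l r) with hM
    have hvm : ∀ (m : ℕ) (j : ℤ), v ϖ ^ j * (v ϖ)⁻¹ ^ m = v ϖ ^ (j - m) := by
      intro m j
      rw [zpow_sub₀ hϖ.pos.ne', zpow_natCast, inv_pow, div_eq_mul_inv]
    refine ⟨(k - M).toNat, (l - M).toNat, ?_⟩
    rw [hpm, hpm, mk_affineGL_eq_iff]
    have h1 : k - ((k - M).toNat : ℤ) = M := by omega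
    have h2 : l - ((l - M).toNat : ℤ) = M := by omega
    simp only [Units.val_mul, Units.val_pow_eq_pow_val, Units.val_inv_eq_inv_val, map_mul, map_pow,
      map_inv₀, ϖu, Units.val_mk0, hk, hl, hvm, h1, h2, true_and]
    exact hr.trans (hϖ.zpow_le_zpow_iff.2 (by omega))

end GeneratesValues

end BruhatTits

/-! ### The main theorem -/

section Action

open ValuativeRel Matrix

variable {K : Type u} [Field K] {Γ₀ : Type*} [LinearOrderedCommGroupWithZero Γ₀]

lemma smul_mk_eq_of_mem_center (v : Valuation K Γ₀) {A : SL(2, K)}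
    (hA : A ∈ Subgroup.center SL(2, K)) (x : GL (Fin 2) K ⧸ vertexSubgroup v) :
    Matrix.SpecialLinearGroup.toGL A • x = x := by
  induction x using QuotientGroup.induction_on with | H g =>
  rcases (Matrix.ProjectiveSpecialLinearGroup.mk_eq_one_iff A).1
    ((QuotientGroup.eq_one_iff A).2 hA) with rfl | rfl
  · rw [map_one, one_smul]
  · rw [MulAction.Quotient.smul_mk, eq_comm, QuotientGroup.eq]
    have h1 : g⁻¹ • (Matrix.SpecialLinearGroup.toGL (-1 : SL(2, K)) • g) = -1 := by
      rw [smul_eq_mul, smul_eq_mul, inv_mul_eq_iff_eq_mul]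
      ext i j
      simp
    rw [smul_eq_mul] at h1
    rw [h1]
    refine ⟨1, one_ne_zero, fun i j => ?_, ?_⟩
    · rw [Units.val_neg, Units.val_one, Matrix.neg_apply, Valuation.map_neg, Matrix.one_apply]
      split_ifs <;> simp
    · simp [Matrix.det_fin_two]

/-- The action of `PSL₂` on the vertices of the tree. -/
@[reducible] noncomputable def vertexAction (v : Valuation K Γ₀) :
    MulAction PSL(2, K) (GL (Fin 2) K ⧸ vertexSubgroup v) :=
  MulAction.compHom _ (QuotientGroup.lift (Subgroup.center SL(2, K))
    ((MulAction.toPermHom (GL (Fin 2) K) (GL (Fin 2) K ⧸ vertexSubgroup v)).comp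
      Matrix.SpecialLinearGroup.toGL) fun _ hA => Equiv.ext (smul_mk_eq_of_mem_center v hA))

end Action

/-! ### Discrete groups acting on the tree. -/

section Main

open ValuativeRel Matrix

variable {K : Type u} [Field K] [ValuativeRel K] [TopologicalSpace K] [IsNonarchimedeanLocalField K]

lemma exists_generatesValues : ∃ ϖ : K, GeneratesValues (valuation K) ϖ := by
  let e := IsNonarchimedeanLocalField.valueGroupWithZeroIsoInt K
  obtain ⟨ϖ, hϖ⟩ := ValuativeRel.valuation_surjective (e.symm (WithZero.exp (-1)))
  have he : e (valuation K ϖ) = WithZero.exp (-1) := by rw [hϖ]; exact e.apply_symm_apply _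
  refine ⟨ϖ, ?_, ?_, fun x hx => ?_⟩
  · rintro rfl
    rw [map_zero, map_zero] at he
    exact WithZero.exp_ne_zero he.symm
  · rw [← map_lt_map_iff e, he, map_one, ← WithZero.exp_zero, WithZero.exp_lt_exp]
    norm_num
  · have hx0 : e (valuation K x) ≠ 0 := by
      rw [Ne, map_eq_zero, map_eq_zero]; exact hx
    refine ⟨-(WithZero.log (e (valuation K x))), e.injective ?_⟩
    change e _ = e _
    rw [map_zpow₀, he, ← WithZero.exp_zsmul]
    simp [WithZero.exp_log hx0]

/-- Conjugation by `g` makes a stabilizing lift integral up to a scalar `c`, and determinant one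
forces `c` to have valuation one. Its entries are thus bounded in terms of `g` alone. -/
lemma finite_stabilizer_vertex (G : Subgroup PSL(2, K)) [DiscreteTopology G]
    (x : GL (Fin 2) K ⧸ vertexSubgroup (valuation K)) :
    letI := vertexAction (valuation K); {b : PSL(2, K) | b ∈ G ∧ b • x = x}.Finite := by
  let := vertexAction (valuation K)
  induction x using QuotientGroup.induction_on with | H g =>
  have hbound : ∀ M : Matrix (Fin 2) (Fin 2) K, ∃ γ, ∀ i j, valuation K (M i j) ≤ γ := by
    intro M
    obtain ⟨γ, h⟩ := (Set.finite_range fun p : Fin 2 × Fin 2 =>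
      M p.1 p.2).isCompact.exists_valuation_le
    exact ⟨γ, fun i j => h _ ⟨(i, j), rfl⟩⟩
  obtain ⟨γ, hγ⟩ := hbound (g : Matrix (Fin 2) (Fin 2) K)
  obtain ⟨δ, hδ⟩ := hbound (g⁻¹ : GL (Fin 2) K)
  refine (Matrix.ProjectiveSpecialLinearGroup.finite_setOf_exists_lift_valuation_le G
    (γ * 1 * δ)).subset ?_
  rintro b ⟨hb, hbx⟩
  induction b using QuotientGroup.induction_on with | H M =>
  refine ⟨hb, M, rfl, ?_⟩
  have h1 : (QuotientGroup.mk (Matrix.SpecialLinearGroup.toGL M * g) :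
    GL (Fin 2) K ⧸ vertexSubgroup (valuation K)) = QuotientGroup.mk g := hbx
  obtain ⟨c, hc, h2, h3⟩ : g⁻¹ * (Matrix.SpecialLinearGroup.toGL M * g) ∈
    scaledIntegral (valuation K) 1 := QuotientGroup.eq.1 h1.symm
  have hdet : ((g⁻¹ * (Matrix.SpecialLinearGroup.toGL M * g) : GL (Fin 2) K) :
      Matrix (Fin 2) (Fin 2) K).det = 1 := by
    rw [Units.val_mul, Units.val_mul, Matrix.det_mul, Matrix.det_mul, mul_comm, mul_assoc,
      ← Matrix.det_mul, ← Units.val_mul, mul_inv_cancel, Units.val_one, Matrix.det_one, mul_one]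
    exact M.det_coe
  rw [hdet, map_one, one_mul, eq_comm] at h3
  have hc1 : valuation K c = 1 := (pow_eq_one_iff_of_nonneg zero_le two_ne_zero).1 h3
  rw [hc1] at h2
  intro i j
  have h4 := valuation_mul_apply_le (valuation_mul_apply_le hγ h2) hδ i j
  rw [← Units.val_mul, ← Units.val_mul] at h4
  have h5 : g * (g⁻¹ * (Matrix.SpecialLinearGroup.toGL M * g)) * g⁻¹ =
    Matrix.SpecialLinearGroup.toGL M := by group
  rw [h5] at h4
  exact h4

theorem theoremB {K : Type u} [Field K] [ValuativeRel K] [TopologicalSpace K]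
    [IsNonarchimedeanLocalField K] [CharZero K]
    (G : Subgroup PSL(2, K))
    (hdiscrete : DiscreteTopology G)
    (htorsion : ∀ g ∈ G, g ^ 2 = 1 → g = 1) :
    ∃ (ι : Type u) (H : ι → Subgroup G),
      IsFreeProductOf H ∧
      ∀ i, IsCyclic (H i) ∨ IsFiniteCyclicProdInfiniteCyclic (H i) := by
  obtain ⟨ϖ, hϖ⟩ := exists_generatesValues (K := K)
  let := vertexAction (valuation K)
  have htwo : ∀ g : G, g ^ 2 = 1 → g = 1 := fun g hg =>
    Subtype.ext (htorsion g g.2 (by simpa using congrArg Subtype.val hg))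
  have htwo' : ∀ g : G, g ≠ 1 → (g : PSL(2, K)) ^ 2 ≠ 1 := fun g hg h =>
    hg (Subtype.ext (htorsion g g.2 h))
  have hinv : ∀ (g : G) (x y : GL (Fin 2) K ⧸ vertexSubgroup (valuation K)),
      hϖ.bruhatTitsGraph.Adj x y → hϖ.bruhatTitsGraph.Adj (g • x) (g • y) := by
    rintro ⟨g, hg⟩ x y h
    induction g using QuotientGroup.induction_on with | H M =>
    exact hϖ.adj_smul (Matrix.SpecialLinearGroup.toGL M) x y h
  have hfin : ∀ x : GL (Fin 2) K ⧸ vertexSubgroup (valuation K),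
      Finite (MulAction.stabilizer G x) := by
    intro x
    have := (finite_stabilizer_vertex G x).to_subtype
    refine Finite.of_injective (fun g : MulAction.stabilizer G x =>
      (⟨(g : G), (g : G).2, g.2⟩ : {b : PSL(2, K) | b ∈ G ∧ b • x = x})) fun g h hgh => ?_
    exact Subtype.ext (Subtype.ext (Subtype.mk.inj hgh))
  have htrans : ∀ a b c : G, a ≠ 1 → Commute a b → Commute a c → Commute b c := by
    intro a b c ha hb hc
    exact Subtype.ext (Matrix.ProjectiveSpecialLinearGroup.commute_of_commute (htwo' a ha)
      (hb.map G.subtype) (hc.map G.subtype))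
  have hstab : ∀ (y : GL (Fin 2) K ⧸ vertexSubgroup (valuation K)) (a b : G),
      a • y = y → b • y = y → Commute a b := by
    intro y a b hay hby
    have : Finite ((MulAction.stabilizer G y).map G.subtype) :=
      Finite.of_equiv _ ((MulAction.stabilizer G y).equivMapOfInjective G.subtype
        G.subtype_injective).toEquiv
    refine Subtype.ext (Matrix.ProjectiveSpecialLinearGroup.commute_of_finite
      (Γ := (MulAction.stabilizer G y).map G.subtype) ?_ ⟨a, hay, rfl⟩ ⟨b, hby, rfl⟩)
    rintro _ ⟨g, -, rfl⟩ hg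
    exact htorsion g g.2 hg
  have hord : ∀ (y : GL (Fin 2) K ⧸ vertexSubgroup (valuation K)) (a : G),
      a • y = y → IsOfFinOrder a := by
    intro y a hay
    have h1 := isOfFinOrder_of_finite (⟨a, hay⟩ : MulAction.stabilizer G y)
    exact (MulAction.stabilizer G y).subtype.isOfFinOrder h1
  have hconj : ∀ a g : G, a ≠ 1 → IsOfFinOrder a → Commute a (g * a * g⁻¹) →
      g * a * g⁻¹ = a ∨ g * a * g⁻¹ = a⁻¹ := by
    intro a g ha hafin hcomm
    have h1 := Matrix.ProjectiveSpecialLinearGroup.conj_eq_or_eq_inv_of_commute (htwo' a ha)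
      (G.subtype.isOfFinOrder hafin) (g := g) (by simpa using hcomm.map G.subtype)
    exact h1.imp (fun h => Subtype.ext h) (fun h => Subtype.ext h)
  obtain ⟨ι, H, hH, hcomp⟩ := exists_isFreeProductOf_stabilizer_fixedEdge_component (G := G)
    hϖ.bruhatTitsGraph_isTree hinv htwo
  refine ⟨ι, H, hH, fun i => ?_⟩
  rcases hcomp i with ⟨x, hx⟩ | h
  swap
  · exact Or.inl h
  rcases eq_bot_or_exists_torsion_commute htwo htrans hstab hord hconj hinv (H i) x hx with
    h | ⟨a, ha, hafin, hcomm⟩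
  · left
    rw [h]
    infer_instance
  · let e := (H i).equivMapOfInjective G.subtype G.subtype_injective
    have hdisc : DiscreteTopology ((H i).map G.subtype) := by
      have hle : (H i).map G.subtype ≤ G := by rintro _ ⟨b, -, rfl⟩; exact b.2
      exact DiscreteTopology.of_subset hdiscrete hle
    rcases Matrix.ProjectiveSpecialLinearGroup.isCyclic_or_prod_of_commute_torsion (htwo' a ha)
      (G.subtype.isOfFinOrder hafin) ((H i).map G.subtype) (by
        rintro _ ⟨b, hb, rfl⟩
        exact (hcomm b hb).map G.subtype) with h | ⟨n, hn, ⟨f⟩⟩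
    · exact Or.inl (e.isCyclic.2 h)
    · exact Or.inr ⟨n, hn, ⟨e.trans f⟩⟩

end Main
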